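/- Let $k$ be a field (for instance a finite field), let $X$ be a smooth, projective, geometrically irreducible curve over $k$, and let $\Gamma \subset X\times_k X$ be a reduced, geometrically irreducible closed subscheme whose two projections $\pi_1,\pi_2 : \Gamma \to X$ are finite and surjective (so $\Gamma$ is an irreducible correspondence on $X$, with no horizontal or vertical component). For $n\ge 1$ let $$C_n=\{(P_1,\dots,P_n)\in X^n \mid (P_i,P_{i+1})\in\Gamma \text{ for } i=1,\dots,n-1\},$$ that is, the scheme-theoretic intersection in $X^n$ of the inverse images of $\Gamma$ under the maps $(P_1,\dots,P_n)\mapsto(P_i,P_{i+1})$. A point of $C_n$ is called singular if $C_n$ is not smooth over $k$ at that point. (1) For every $n\ge 1$, a point $(P_1,\dots,P_n)$ of $C_n$ is singular if and only if there exist indices $1\le i\le j<n$ such that $\pi_2$ is not étale at $(P_i,P_{i+1})\in\Gamma$ and $\pi_1$ is not étale at $(P_j,P_{j+1})\in\Gamma$. (2) Let $f,g:\mathbb P^1_k\to\mathbb P^1_k$ be two non-constant $k$-morphisms, let $\Gamma_{f,g}=\{(P,Q)\in\mathbb P^1\times\mathbb P^1\mid f(P)=g(Q)\}$ be their fibre product,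 and let $C_n=\{(P_1,\dots,P_n)\in(\mathbb P^1)^n\mid f(P_i)=g(P_{i+1}),\ 1\le i<n\}$, with its natural scheme structure. For every $n \geq 1$, a point $(P_1,\dots,P_n)$ of $C_n$ is singular if and only if there exist $1\le i<j\le n$ such that $f$ is ramified (i.e. not unramified) at $P_i$ and $g$ is ramified at $P_j$. Here points are arbitrary points of the scheme $C_n$, and the $P_i$ and $(P_i,P_{i+1})$ are their images in $X$ and in $\Gamma$. -/

import Mathlib

open CategoryTheory CategoryTheory.Limits AlgebraicGeometry

universe u

namespace RecursiveTower

/-! ### Local properties of morphisms at a point -/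

/-- The morphism `f` is étale at the point `x`: it is étale on an open neighbourhood of `x`. -/
def IsEtaleAt {Y Z : Scheme.{u}} (f : Y ⟶ Z) (x : Y) : Prop :=
  ∃ U : Y.Opens, x ∈ U ∧ Etale (U.ι ≫ f)

/-- For a scheme `Y` of finite type over a field, with structure morphism `s`: the point `x` is
singular, i.e. `Y` is not smooth over the field at `x`. -/
def IsSingularPoint {Y S : Scheme.{u}} (s : Y ⟶ S) (x : Y) : Prop :=
  ¬ ∃ U : Y.Opens, x ∈ U ∧ Smooth (U.ι ≫ s)

/-- For a morphism `f` locally of finite type: `f` is ramified at the point `x`, i.e. it is not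
unramified on any open neighbourhood of `x`. -/
def IsRamifiedAt {Y Z : Scheme.{u}} (f : Y ⟶ Z) (x : Y) : Prop :=
  ¬ ∃ U : Y.Opens, x ∈ U ∧ FormallyUnramified (U.ι ≫ f)

/-! ### The singular recursive tower -/

section Tower

variable {X S : Scheme.{u}} (s : X ⟶ S)

/-- The `n`-fold fibre product `X ×_S ⋯ ×_S X`. -/
noncomputable abbrev power (n : ℕ) : Scheme.{u} :=
  widePullback S (fun _ : Fin n => X) (fun _ => s)

/-- The structure morphism of `X ×_S ⋯ ×_S X`. -/
noncomputable def powerStruct (n : ℕ) : power s n ⟶ S :=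
  WidePullback.base (fun _ : Fin n => s)

/-- The coordinate `(P_0, …, P_{n-1}) ↦ P_i` on `X ×_S ⋯ ×_S X`. -/
noncomputable def powerCoord {n : ℕ} (i : Fin n) : power s n ⟶ X :=
  WidePullback.π (fun _ : Fin n => s) i

lemma powerCoord_comp {n : ℕ} (i : Fin n) : powerCoord s i ≫ s = powerStruct s n :=
  WidePullback.π_arrow (fun _ : Fin n => s) i

/-- The morphism `(P_0, …, P_m) ↦ (P_i, P_{i+1})` to `X ×_S X`, for `0 ≤ i < m`. -/
noncomputable def powerPair {m : ℕ} (i : Fin m) : power s (m + 1) ⟶ pullback s s :=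
  pullback.lift (powerCoord s i.castSucc) (powerCoord s i.succ)
    (by rw [powerCoord_comp, powerCoord_comp])

variable {Γ : Scheme.{u}} (ι : Γ ⟶ pullback s s)

/-- The first projection `π₁ : Γ → X`, `(P, Q) ↦ P`. -/
noncomputable def proj₁ : Γ ⟶ X := ι ≫ pullback.fst s s

/-- The second projection `π₂ : Γ → X`, `(P, Q) ↦ Q`. -/
noncomputable def proj₂ : Γ ⟶ X := ι ≫ pullback.snd s s

/-- The curve `C_{m+1} = {(P_0, …, P_m) ∈ X^{m+1} | (P_i, P_{i+1}) ∈ Γ for 0 ≤ i < m}`, as the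
scheme-theoretic intersection in `X^{m+1}` (that is, the fibre product over `X^{m+1}`) of the
inverse images of `Γ ⊆ X × X` under the morphisms `(P_0, …, P_m) ↦ (P_i, P_{i+1})`. -/
noncomputable abbrev curve (m : ℕ) : Scheme.{u} :=
  widePullback (power s (m + 1)) (fun i : Fin m => pullback ι (powerPair s i))
    (fun i => pullback.snd ι (powerPair s i))

/-- The embedding of `C_{m+1}` in `X^{m+1}`. -/
noncomputable def curveEmb (m : ℕ) : curve s ι m ⟶ power s (m + 1) :=
  WidePullback.base (fun i : Fin m => pullback.snd ι (powerPair s i))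

/-- The structure morphism of `C_{m+1}`. -/
noncomputable def curveStruct (m : ℕ) : curve s ι m ⟶ S :=
  curveEmb s ι m ≫ powerStruct s (m + 1)

/-- The coordinate `(P_0, …, P_m) ↦ P_i` on `C_{m+1}`. -/
noncomputable def coord {m : ℕ} (i : Fin (m + 1)) : curve s ι m ⟶ X :=
  curveEmb s ι m ≫ powerCoord s i

/-- The morphism `(P_0, …, P_m) ↦ (P_i, P_{i+1})` from `C_{m+1}` to `Γ`. -/
noncomputable def pairPoint {m : ℕ} (i : Fin m) : curve s ι m ⟶ Γ :=
  WidePullback.π (fun i : Fin m => pullback.snd ι (powerPair s i)) i ≫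
    pullback.fst ι (powerPair s i)

lemma pairPoint_comp {m : ℕ} (i : Fin m) :
    pairPoint s ι i ≫ ι = curveEmb s ι m ≫ powerPair s i := by
  have h := WidePullback.π_arrow (fun i : Fin m => pullback.snd ι (powerPair s i)) i
  have hc := pullback.condition (f := ι) (g := powerPair s i)
  exact (Category.assoc _ _ _).trans
    (((congrArg (WidePullback.π (fun i : Fin m => pullback.snd ι (powerPair s i)) i ≫ ·) hc).trans
      (Category.assoc _ _ _).symm).trans (congrArg (· ≫ powerPair s i) h))

lemma pairPoint_proj₁ {m : ℕ} (i : Fin m) :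
    pairPoint s ι i ≫ proj₁ s ι = coord s ι i.castSucc := by
  rw [proj₁, ← Category.assoc, pairPoint_comp, Category.assoc, powerPair, pullback.lift_fst, coord]

lemma pairPoint_proj₂ {m : ℕ} (i : Fin m) :
    pairPoint s ι i ≫ proj₂ s ι = coord s ι i.succ := by
  rw [proj₂, ← Category.assoc, pairPoint_comp, Category.assoc, powerPair, pullback.lift_snd, coord]

end Tower

/-! ### The projective line and correspondences with separated variables -/

section ProjectiveLine

attribute [local instance] MvPolynomial.gradedAlgebra

/-- The projective line `Proj k[T₀, T₁]`. -/
noncomputable def P1 (k : Type u) [Field k] : Scheme.{u} :=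
  Proj (MvPolynomial.homogeneousSubmodule (Fin 2) k)

/-- The structure morphism of the projective line over `k`. -/
noncomputable def P1Struct (k : Type u) [Field k] : P1 k ⟶ Spec (CommRingCat.of k) :=
  Proj.toSpecZero (MvPolynomial.homogeneousSubmodule (Fin 2) k) ≫
    Spec.map (CommRingCat.ofHom
      (algebraMap k (MvPolynomial.homogeneousSubmodule (Fin 2) k 0)))

end ProjectiveLine

/-- The embedding in `X ×_S X` of `Γ_{f,g} = {(P, Q) ∈ X ×_S X | f(P) = g(Q)}`, the fibre product
of two `S`-morphisms `f, g : X ⟶ X`. -/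
noncomputable def separatedEmb {X S : Scheme.{u}} (s : X ⟶ S) (f g : X ⟶ X)
    (hf : f ≫ s = s) (hg : g ≫ s = s) : pullback f g ⟶ pullback s s :=
  pullback.lift (pullback.fst f g) (pullback.snd f g) (by
    calc pullback.fst f g ≫ s = pullback.fst f g ≫ f ≫ s := by rw [hf]
      _ = pullback.snd f g ≫ g ≫ s := by rw [← Category.assoc, pullback.condition, Category.assoc]
      _ = pullback.snd f g ≫ s := by rw [hg])

end RecursiveTower

/-! Think of a point of $C_{m+1}$ as a path with vertices $P_0,\dots,P_m$ in $X$ and edges in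
$\Gamma$. Both parts reduce to `isSingularPoint_iff`, which needs only that the two projections of
$\Gamma$ are flat and locally of finite presentation and that $\pi_1$ is quasi-finite.

Smoothness. Forgetting the last vertex is a base change of $\pi_1$ (`exists_isPullback_curve`). If
$\pi_1$ is étale at the last edge, this map is étale at the point and induction applies. Otherwise
$\pi_2$ is étale at every edge, so the last coordinate is étale onto the smooth curve $X$.

Singularity. Let $K$ be the residue field of the point. Tangent vectors are derivations into $K$, or
equivalently maps from the spectrum of $K[\varepsilon]$. Each vertex contributes a tangent line $K$,
and each edge a nonzero subspace of $K^2$, the tangent space of $\Gamma$. That subspace contains the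
solutions of one linear equation $\alpha z+\beta z'=0$, with $\alpha=0$ if $\pi_2$ is ramified and
$\beta=0$ if $\pi_1$ is ramified (`exists_edge_equation`). The solutions of the resulting bidiagonal
system are tangent vectors of $C_{m+1}$. When $\alpha_i=0$ and $\beta_j=0$ with $i\le j$, the rows
are dependent and the solution space has dimension at least 2 (`two_le_finrank_ker_bidiagonal`). A
smooth neighbourhood would be quasi-finite over $X$, hence of dimension at most 1
(`relativeDimension_le_one`), a contradiction.

Flatness comes from `flat_of_denseRange`: locally $X$ is étale over the affine line, where
torsion-free means flat. In part (2), $\pi_1$ and $\pi_2$ are base changes of $g$ and $f$, and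
ramification at a point is unchanged by base change (`IsRamifiedAt.of_isPullback`). -/

namespace RecursiveTower

/-! ### Kernels of bidiagonal systems -/

section LinearAlgebra

/-- The linear map with bidiagonal matrix, with entries `α e` on the diagonal and `β e` next to
it. -/
def bidiagonal {K : Type*} [Field K] {m : ℕ} (α β : Fin m → K) :
    (Fin (m + 1) → K) →ₗ[K] (Fin m → K) :=
  LinearMap.pi fun e => α e • LinearMap.proj e.castSucc + β e • LinearMap.proj e.succ

@[simp]
lemma bidiagonal_apply {K : Type*} [Field K] {m : ℕ} (α β : Fin m → K) (x : Fin (m + 1) → K)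
    (e : Fin m) : bidiagonal α β x e = α e * x e.castSucc + β e * x e.succ := rfl

/-- The vanishing of `α i` and `β j` leaves rows `i, …, j` involving only the variables `i + 1, …,
j`, one fewer than the rows. These rows are dependent, so the rank is less than `m`. -/
lemma two_le_finrank_ker_bidiagonal {K : Type*} [Field K] {m : ℕ} (α β : Fin m → K) {i j : Fin m}
    (hij : i ≤ j) (hi : α i = 0) (hj : β j = 0) :
    2 ≤ Module.finrank K (LinearMap.ker (bidiagonal α β)) := by
  have hsurj : ¬ Function.Surjective (bidiagonal α β) := by
    intro hs
    let res : (Fin m → K) →ₗ[K] (Finset.Icc i j → K) := LinearMap.funLeft K K Subtype.val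
    have hres : Function.Surjective res := LinearMap.funLeft_surjective_of_injective _ _ _
      Subtype.val_injective
    let S : Finset (Fin (m + 1)) := Finset.Ioc i.castSucc j.castSucc
    let ext : (S → K) →ₗ[K] (Fin (m + 1) → K) :=
      LinearMap.pi fun v => if h : v ∈ S then LinearMap.proj ⟨v, h⟩ else 0
    have hext : Function.Surjective (res ∘ₗ bidiagonal α β ∘ₗ ext) := by
      intro y
      obtain ⟨z, hz⟩ := (hres.comp hs) y
      refine ⟨fun v => z v, ?_⟩
      rw [← hz]
      funext e
      have key : ∀ v, ext (fun v => z v) v = if v ∈ S then z v else 0 := by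
        intro v
        by_cases h : v ∈ S <;> simp [ext, h]
      obtain ⟨e, he⟩ := e
      rw [Finset.mem_Icc] at he
      simp only [res, LinearMap.comp_apply, LinearMap.funLeft_apply, Function.comp_apply,
        bidiagonal_apply, key]
      congr 1
      · by_cases h : e = i
        · subst h; simp [hi]
        · have : e.castSucc ∈ S := by
            simp only [S, Finset.mem_Ioc, Fin.castSucc_lt_castSucc_iff, Fin.castSucc_le_castSucc_iff]
            exact ⟨lt_of_le_of_ne he.1 (Ne.symm h), he.2⟩
          rw [if_pos this]
      · by_cases h : e = j
        · subst h; simp [hj]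
        · have : e.succ ∈ S := by
            have h1 := he.1
            have h2 := lt_of_le_of_ne he.2 h
            simp only [S, Finset.mem_Ioc, Fin.lt_def, Fin.le_def, Fin.val_castSucc,
              Fin.val_succ] at h1 h2 ⊢
            omega
          rw [if_pos this]
    have hle := LinearMap.finrank_le_finrank_of_surjective hext
    simp only [Module.finrank_fintype_fun_eq_card, Fintype.card_coe, S, Fin.card_Icc,
      Fin.card_Ioc, Fin.val_castSucc] at hle
    have := Fin.le_def.mp hij
    omega
  have h1 := LinearMap.finrank_range_add_finrank_ker (bidiagonal α β)
  have h2 : Module.finrank K (LinearMap.range (bidiagonal α β)) < m := by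
    have := Submodule.finrank_lt (s := LinearMap.range (bidiagonal α β))
      (fun h => hsurj (LinearMap.range_eq_top.mp h))
    simpa using this
  simp only [Module.finrank_fintype_fun_eq_card, Fintype.card_fin] at h1
  omega

end LinearAlgebra

/-! ### Tangent spaces as derivations at field-valued points -/

section PointDerivations

variable {A B C K : Type*} [CommRing A] [CommRing B] [CommRing C] [Field K]

/-- The derivations of the `A`-algebra `B` at the `K`-valued point `p`. -/
def pointDer (φ : A →+* B) (p : B →+* K) : Submodule K (B → K) where
  carrier := {d | (∀ x y, d (x + y) = d x + d y) ∧ (∀ x y, d (x * y) = p x * d y + p y * d x) ∧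
    ∀ a, d (φ a) = 0}
  add_mem' := by
    rintro d e ⟨h1, h2, h3⟩ ⟨g1, g2, g3⟩
    refine ⟨fun x y => ?_, fun x y => ?_, fun a => ?_⟩ <;> simp only [Pi.add_apply]
    · rw [h1, g1]; ring
    · rw [h2, g2]; ring
    · rw [h3, g3, add_zero]
  zero_mem' := by simp
  smul_mem' := by
    rintro c d ⟨h1, h2, h3⟩
    refine ⟨fun x y => ?_, fun x y => ?_, fun a => ?_⟩ <;> simp only [Pi.smul_apply, smul_eq_mul]
    · rw [h1]; ring
    · rw [h2]; ring
    · rw [h3, mul_zero]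

/-- Restriction of derivations at a point along a ring homomorphism. -/
def pointDerRestrict {φ : A →+* B} {ψ : A →+* C} (γ : B →+* C) (p : C →+* K)
    (h : ψ = γ.comp φ) : pointDer ψ p →ₗ[K] pointDer φ (p.comp γ) :=
  (LinearMap.funLeft K K γ).restrict fun d hd => ⟨fun x y => by simp [hd.1],
    fun x y => by simp [hd.2.1], fun a => by simpa [h] using hd.2.2 a⟩

open KaehlerDifferential in
/-- Derivations at a point are functionals on the Kähler differentials. -/
noncomputable def pointDerEquiv [Algebra A B] [Algebra B K] :
    (Ω[B⁄A] →ₗ[B] K) ≃ₗ[K] pointDer (algebraMap A B) (algebraMap B K) where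
  toFun L := ⟨fun b => L (D A B b), by
    refine ⟨fun x y => by simp, fun x y => by simp [Algebra.smul_def], fun a => by simp⟩⟩
  map_add' L L' := rfl
  map_smul' c L := rfl
  invFun d :=
    letI : Algebra A K := ((algebraMap B K).comp (algebraMap A B)).toAlgebra
    haveI : IsScalarTower A B K := .of_algebraMap_eq' rfl
    Derivation.liftKaehlerDifferential (R := A) (S := B) (M := K)
      (Derivation.mk' (R := A)
        { toFun := d.1
          map_add' := d.2.1
          map_smul' := fun a b => by
            rw [Algebra.smul_def, d.2.2.1, d.2.2.2, mul_zero, add_zero, RingHom.id_apply,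
              Algebra.smul_def]; rfl }
        (fun x y => by
          simp only [LinearMap.coe_mk, AddHom.coe_mk, Algebra.smul_def]
          exact d.2.2.1 x y))
  left_inv L := by
    let : Algebra A K := ((algebraMap B K).comp (algebraMap A B)).toAlgebra
    have : IsScalarTower A B K := .of_algebraMap_eq' rfl
    apply Derivation.liftKaehlerDifferential_unique
    ext b
    simp
  right_inv d := by
    let : Algebra A K := ((algebraMap B K).comp (algebraMap A B)).toAlgebra
    have : IsScalarTower A B K := .of_algebraMap_eq' rfl
    ext b
    simp

/-- A standard smooth algebra of relative dimension `n` has an `n`-dimensional tangent space at each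
point. -/
lemma nonempty_pointDer_equiv {φ : A →+* B} {n : ℕ} (hφ : φ.IsStandardSmoothOfRelativeDimension n)
    (p : B →+* K) : Nonempty (pointDer φ p ≃ₗ[K] (Fin n → K)) := by
  algebraize [φ, p]
  have : Nontrivial B := p.domain_nontrivial
  have : Algebra.IsStandardSmooth A B := hφ.isStandardSmooth
  let b := Module.Free.chooseBasis B Ω[B⁄A]
  have hr := Algebra.IsStandardSmoothOfRelativeDimension.rank_kaehlerDifferential (R := A) (S := B) n
  have hb : Module.finrank B Ω[B⁄A] = n := Module.finrank_eq_of_rank_eq hr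
  let b' : Module.Basis (Fin n) B Ω[B⁄A] := b.reindex (Fintype.equivFinOfCardEq
    (by rw [← Module.finrank_eq_card_chooseBasisIndex, hb]))
  exact ⟨(pointDerEquiv (A := A) (B := B) (K := K)).symm.trans (b'.constr K).symm⟩

open TensorProduct in
/-- A ramified point has a nonzero relative tangent vector. -/
lemma exists_pointDer_ne_zero {φ : A →+* B} (hφ : φ.FiniteType) (p : B →+* K)
    (h : ∀ g, p g ≠ 0 → ¬ ((algebraMap B (Localization.Away g)).comp φ).FormallyUnramified) :
    ∃ d ∈ pointDer φ p, d ≠ 0 := by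
  algebraize [φ, p]
  let q : Ideal B := RingHom.ker p
  have hq : q.IsPrime := RingHom.ker_isPrime p
  have hq' : ¬ Algebra.IsUnramifiedAt A q := by
    intro hun
    obtain ⟨g, hg, H⟩ := Algebra.exists_formallyUnramified_of_isUnramifiedAt (R := A) q
    refine h g hg ?_
    have := RingHom.formallyUnramified_algebraMap.mpr H
    rwa [IsScalarTower.algebraMap_eq A B] at this
  have hsupp : (⟨q, hq⟩ : PrimeSpectrum B) ∈ Module.support B Ω[B⁄A] := by
    by_contra hc
    apply hq'
    have : (⟨q, hq⟩ : PrimeSpectrum B) ∈ Algebra.unramifiedLocus A B := by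
      rw [Algebra.unramifiedLocus_eq_compl_support]; exact hc
    exact this
  -- By Nakayama, since the differentials are finitely generated, the fibre at `q` is nonzero. A
  -- nonzero functional on it, followed by the embedding of the residue field in `K`, is the
  -- required derivation.
  rw [Module.mem_support_iff_nontrivial_residueField_tensorProduct] at hsupp
  let κ := q.ResidueField
  obtain ⟨x, hx⟩ := exists_ne (0 : κ ⊗[B] Ω[B⁄A])
  obtain ⟨f, hf⟩ : ∃ f : Module.Dual κ (κ ⊗[B] Ω[B⁄A]), f x ≠ 0 := by
    by_contra! hc
    exact hx ((Module.forall_dual_apply_eq_zero_iff κ x).mp hc)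
  let r : κ →ₐ[B] K := Ideal.ResidueField.liftₐ q (Algebra.ofId B K) le_rfl
    fun b hb => isUnit_iff_ne_zero.mpr hb
  let L : Ω[B⁄A] →ₗ[B] K :=
    r.toLinearMap ∘ₗ (f.restrictScalars B) ∘ₗ TensorProduct.mk B κ Ω[B⁄A] 1
  have hL : L ≠ 0 := by
    intro hL
    apply hf
    have h1 : ∀ ω, f (1 ⊗ₜ ω) = 0 := fun ω => by
      have : r (f (1 ⊗ₜ ω)) = 0 := LinearMap.congr_fun hL ω
      exact (map_eq_zero r).mp this
    have h0 : f = 0 := by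
      ext ω
      simpa using h1 (KaehlerDifferential.D A B ω)
    rw [h0, LinearMap.zero_apply]
  refine ⟨(pointDerEquiv (A := A) (B := B) (K := K) L).1, (pointDerEquiv L).2, fun h0 => hL ?_⟩
  exact (pointDerEquiv (A := A) (B := B) (K := K)).injective (by
    rw [map_zero]; exact Subtype.ext h0)

end PointDerivations

/-! ### Étale coordinates and dimension one -/

section Algebra

lemma isRegular_map_of_flat {R S : Type*} [CommRing R] [IsDomain R] [CommRing S] {f : R →+* S}
    (hf : f.Flat) {r : R} (hr : r ≠ 0) : f r ∈ nonZeroDivisors S := by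
  algebraize [f]
  have h : IsSMulRegular S (f r) :=
    IsSMulRegular.of_flat (S := S) (x := r) (IsLeftCancelMulZero.mul_left_cancel_of_ne_zero hr)
  rw [mem_nonZeroDivisors_iff_right]
  intro x hx
  exact h (by simpa [mul_comm] using hx)

lemma injective_of_flat {R S : Type*} [CommRing R] [IsDomain R] [CommRing S] [Nontrivial S]
    {f : R →+* S} (hf : f.Flat) : Function.Injective f := by
  rw [injective_iff_map_eq_zero]
  intro r hr
  by_contra h
  exact zero_notMem_nonZeroDivisors (hr ▸ isRegular_map_of_flat hf h)

/-- Étale coordinates on a standard smooth algebra of relative dimension one. -/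
lemma exists_etale_polynomial {k A : Type u} [CommRing k] [CommRing A] {φ : k →+* A}
    (hφ : φ.IsStandardSmoothOfRelativeDimension 1) :
    ∃ g : Polynomial k →+* A, g.comp Polynomial.C = φ ∧ g.Etale := by
  obtain ⟨g, hg, hg'⟩ := hφ.exists_etale_mvPolynomial
  let e := (MvPolynomial.uniqueAlgEquiv k (Fin 1)).symm
  refine ⟨g.comp e.toRingEquiv.toRingHom, ?_, RingHom.Etale.respectsIso.2 g _ hg'⟩
  rw [← hg]
  ext c
  have : e (Polynomial.C c) = MvPolynomial.C c := e.commutes c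
  simp [this]

lemma quasiFinite_of_etale {R S : Type*} [CommRing R] [CommRing S] {f : R →+* S}
    (hf : f.Etale) : f.QuasiFinite := by
  algebraize [f]
  exact inferInstanceAs (Algebra.QuasiFinite R S)

/-- A smooth algebra that is quasi-finite over a smooth algebra of dimension one has dimension at
most one. -/
lemma relativeDimension_le_one {k A B : Type u} [Field k] [CommRing A] [CommRing B] [Nontrivial B]
    {φ : k →+* A} {ψ : A →+* B} {d : ℕ} (hφ : φ.IsStandardSmoothOfRelativeDimension 1)
    (hψ : ψ.QuasiFinite) (hd : (ψ.comp φ).IsStandardSmoothOfRelativeDimension d) : d ≤ 1 := by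
  obtain ⟨g, hg, hge⟩ := hd.exists_etale_mvPolynomial
  obtain ⟨h, hh, hhe⟩ := exists_etale_polynomial hφ
  obtain ⟨q, hq⟩ : (minimalPrimes B).Nonempty := by
    obtain ⟨m, hm⟩ := Ideal.exists_maximal B
    obtain ⟨q, hq, -⟩ := Ideal.exists_minimalPrimes_le (I := ⊥) (J := m) bot_le
    exact ⟨q, hq⟩
  have hqp : q.IsPrime := hq.1.1
  let κ := q.ResidueField
  let r : B →+* κ := algebraMap B κ
  have hrψ : (r.comp (ψ.comp h)).QuasiFinite := by
    refine RingHom.QuasiFinite.comp ?_ (hψ.comp (quasiFinite_of_etale hhe))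
    exact RingHom.quasiFinite_algebraMap.mpr inferInstance
  let : Algebra k κ := (r.comp (ψ.comp φ)).toAlgebra
  -- Nonzero polynomials become nonzerodivisors by flatness, and these avoid the minimal prime `q`;
  -- so the `d` étale coordinates stay algebraically independent in the residue field.
  have hinj : Function.Injective (r.comp g) := by
    rw [injective_iff_map_eq_zero]
    intro x hx
    by_contra hx0
    have h1 := isRegular_map_of_flat (RingHom.Etale.iff_flat_and_formallyUnramified.mp hge).1 hx0
    have h2 : g x ∈ q := Ideal.algebraMap_residueField_eq_zero.mp hx
    exact Set.disjoint_left.mp (Ideal.disjoint_nonZeroDivisors_of_mem_minimalPrimes hq) h2 h1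
  have hind : AlgebraicIndependent k (fun i : Fin d => r (g (MvPolynomial.X i))) := by
    have : (MvPolynomial.aeval fun i : Fin d => r (g (MvPolynomial.X i))).toRingHom = r.comp g := by
      ext a
      · simp [RingHom.algebraMap_toAlgebra, ← hg]
      · simp
    intro x y hxy
    exact hinj ((congr($this x)).symm.trans (Eq.trans hxy congr($this y)))
  have hle := hind.lift_cardinalMk_le_trdeg
  -- The residue field is quasi-finite, hence finite, over `k(t)`, so its transcendence degree over
  -- `k` is at most one.
  let t : κ := r (ψ (h Polynomial.X))
  let F := IntermediateField.adjoin k {t}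
  let hF : Polynomial k →+* F := (Polynomial.aeval (R := k) (A := F)
    ⟨t, IntermediateField.mem_adjoin_simple_self k t⟩).toRingHom
  have hFκ : (algebraMap F κ).comp hF = r.comp (ψ.comp h) := by
    ext a
    · simp [hF, RingHom.algebraMap_toAlgebra, ← hh]
    · simp [hF, t]
  have hFq : (algebraMap F κ).QuasiFinite := RingHom.QuasiFinite.of_comp (hFκ ▸ hrψ)
  have : Algebra.QuasiFinite F κ := RingHom.quasiFinite_algebraMap.mp hFq
  have : Module.Finite F κ := .of_quasiFinite
  have : Algebra.IsAlgebraic (Algebra.adjoin k {t}) κ :=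
    IntermediateField.isAlgebraic_adjoin_iff_top.mp inferInstance
  have h1 := Algebra.IsAlgebraic.trdeg_le_cardinalMk (R := k) (A := κ) {t}
  have := hle.trans (Cardinal.lift_le.mpr h1)
  simpa using this

/-- In a domain étale over a polynomial ring in one variable over a field, nonzero primes are
maximal. -/
lemma isMaximal_of_etale_polynomial {k A : Type u} [Field k] [CommRing A] [IsDomain A]
    {g : Polynomial k →+* A} (hg : g.Etale) (p : Ideal A) [p.IsPrime] (hp : p ≠ ⊥) :
    p.IsMaximal := by
  have hq := quasiFinite_of_etale hg
  algebraize [g]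
  -- Distinct primes over the same prime are incomparable by quasi-finiteness, and `⊥` lies over `⊥`
  -- by injectivity.
  have h0 : p.under (Polynomial k) ≠ ⊥ := by
    intro h
    refine hp (Algebra.QuasiFinite.eq_of_le_of_under_eq (R := Polynomial k) ⊥ p bot_le ?_).symm
    rw [h]
    exact RingHom.ker_eq_bot_iff_eq_zero _ |>.mpr fun x hx =>
      injective_of_flat (RingHom.Etale.iff_flat_and_formallyUnramified.mp hg).1 (hx.trans (map_zero _).symm)
  have hmax : (p.under (Polynomial k)).IsMaximal :=
    Ring.DimensionLEOne.maximalOfPrime h0 inferInstance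
  obtain ⟨m, hm, hpm⟩ := Ideal.exists_le_maximal p (Ideal.IsPrime.ne_top ‹_›)
  have : p = m := by
    refine Algebra.QuasiFinite.eq_of_le_of_under_eq (R := Polynomial k) p m hpm ?_
    exact hmax.eq_of_le (Ideal.IsPrime.ne_top inferInstance) (Ideal.comap_mono hpm)
  exact this ▸ hm

end Algebra

/-! ### Affine charts -/

section Charts

lemma exists_opens_of_openImmersion {P : MorphismProperty Scheme.{u}} [P.IsStableUnderBaseChange]
    {W Y Z : Scheme.{u}} (j : W ⟶ Y) [IsOpenImmersion j] (f : Y ⟶ Z) (h : P (j ≫ f)) (w : W) :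
    ∃ U : Y.Opens, j w ∈ U ∧ P (U.ι ≫ f) := by
  have : P.RespectsIso := MorphismProperty.IsStableUnderBaseChange.respectsIso
  refine ⟨j.opensRange, ⟨w, rfl⟩, ?_⟩
  rw [← P.cancel_left_of_respectsIso j.isoOpensRange.hom, ← Category.assoc,
    Scheme.Hom.isoOpensRange_hom_ι]
  exact h

/-- Affine charts in which a property of morphisms to an affine scheme that is defined locally in
terms of ring homomorphisms is satisfied. -/
lemma exists_chart {P : MorphismProperty Scheme.{u}}
    {Q : ∀ {R S : Type u} [CommRing R] [CommRing S], (R →+* S) → Prop}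
    [HasRingHomProperty P (RingHom.Locally Q)] {k : CommRingCat.{u}} {Y : Scheme.{u}}
    (f : Y ⟶ Spec k) (U : Y.Opens) (h : P (U.ι ≫ f)) (y : Y) (hy : y ∈ U) :
    ∃ (R : CommRingCat.{u}) (j : Spec R ⟶ Y) (φ : k ⟶ R), IsOpenImmersion j ∧
      y ∈ Set.range j ∧ (∀ x, j x ∈ U) ∧ j ≫ f = Spec.map φ ∧ Q φ.hom := by
  obtain ⟨_, ⟨V, hV, rfl⟩, hyV, hVU⟩ :=
    Y.isBasis_affineOpens.exists_subset_of_mem_open hy U.isOpen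
  replace hV : IsAffineOpen V := hV
  obtain ⟨φ, hφ⟩ := Spec.map_surjective (hV.fromSpec ≫ f)
  have hrange : Set.range hV.fromSpec ⊆ Set.range U.ι := by
    rw [hV.range_fromSpec, Scheme.Opens.range_ι]; exact hVU
  have hP : P (Spec.map φ) := by
    rw [hφ, ← IsOpenImmersion.lift_fac U.ι hV.fromSpec hrange, Category.assoc]
    exact IsZariskiLocalAtSource.comp h _
  rw [HasRingHomProperty.Spec_iff (P := P)] at hP
  obtain ⟨s, hs, hQ⟩ := hP
  obtain ⟨x, rfl⟩ : y ∈ Set.range hV.fromSpec := by rw [hV.range_fromSpec]; exact hyV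
  obtain ⟨t, hts, htx⟩ : ∃ t ∈ s, t ∉ x.asIdeal := by
    by_contra! hc
    exact x.2.ne_top (top_le_iff.mp (hs ▸ Ideal.span_le.mpr hc))
  let r : Γ(Y, V) ⟶ .of (Localization.Away t) := CommRingCat.ofHom (algebraMap _ _)
  have : IsOpenImmersion (Spec.map r) := inferInstanceAs (IsOpenImmersion (Spec.map
    (CommRingCat.ofHom (algebraMap Γ(Y, V) (Localization.Away t)))))
  refine ⟨.of (Localization.Away t), Spec.map r ≫ hV.fromSpec, φ ≫ r, inferInstance, ?_, ?_, ?_,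
    hQ t hts⟩
  · have : x ∈ Set.range (Spec.map r) := by
      have := PrimeSpectrum.localization_away_comap_range (Localization.Away t) t
      exact this.ge htx
    obtain ⟨z, rfl⟩ := this
    exact ⟨z, by simp⟩
  · intro z
    have : hV.fromSpec (Spec.map r z) ∈ Set.range hV.fromSpec := ⟨_, rfl⟩
    rw [hV.range_fromSpec] at this
    simpa using hVU this
  · rw [Category.assoc, ← hφ, Spec.map_comp]

end Charts

/-! ### Étale versus unramified for flat morphisms -/

section EtaleLocus

lemma isEtaleAt_iff_not_isRamifiedAt {Y Z : Scheme.{u}} (f : Y ⟶ Z) [Flat f]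
    [LocallyOfFinitePresentation f] (y : Y) : IsEtaleAt f y ↔ ¬ IsRamifiedAt f y := by
  rw [IsRamifiedAt, not_not]
  constructor
  · rintro ⟨U, hy, h⟩
    exact ⟨U, hy, inferInstance⟩
  · rintro ⟨U, hy, h⟩
    exact ⟨U, hy, Etale.of_formallyUnramified_of_flat _⟩

end EtaleLocus

/-! ### Tangent vectors as maps from the dual numbers -/

section Tangent

variable {K : Type u} [Field K]

/-- The closed point of the spectrum of the dual numbers. -/
noncomputable def dualPoint (K : Type u) [Field K] :
    Spec (.of K) ⟶ Spec (.of (DualNumber K)) :=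
  Spec.map (CommRingCat.ofHom (TrivSqZeroExt.fstHom K K K).toRingHom)

/-- The kernel of $\varepsilon\mapsto 0$ squares to zero, so it lies in every prime. Hence a tangent
vector factors through any open set containing its base point. -/
lemma dualPoint_surjective : Function.Surjective (dualPoint K) := by
  have hs : Function.Surjective (TrivSqZeroExt.fstHom K K K).toRingHom :=
    TrivSqZeroExt.fst_surjective
  intro x
  have := _root_.range_comap_of_surjective _ _ hs
  have hx : x ∈ Set.range (PrimeSpectrum.comap (TrivSqZeroExt.fstHom K K K).toRingHom) := by
    rw [this]
    intro a ha
    have ha' : a ^ 2 = 0 := by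
      have : a.fst = 0 := ha
      ext <;> simp [this]
    exact x.2.mem_of_pow_mem 2 (ha' ▸ x.asIdeal.zero_mem)
  exact hx

/-- The homomorphism to the dual numbers given by a derivation at a point. -/
def dualHom {A B : Type*} [CommRing A] [CommRing B] {φ : A →+* B} {p : B →+* K}
    (d : pointDer φ p) : B →+* DualNumber K where
  toFun b := TrivSqZeroExt.inl (p b) + TrivSqZeroExt.inr (d.1 b)
  map_one' := by
    have h := d.2.2.1 1 1
    simp only [mul_one, map_one, one_mul, left_eq_add] at h
    ext <;> simp [h]
  map_mul' x y := by
    have h := d.2.2.1 x y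
    ext
    · simp
    · simp [h, mul_comm]
  map_zero' := by
    have h := d.2.1 0 0
    simp only [add_zero, left_eq_add] at h
    ext <;> simp [h]
  map_add' x y := by
    have h := d.2.1 x y
    ext <;> simp [h]

section
variable {A B C : Type*} [CommRing A] [CommRing B] [CommRing C] {φ : A →+* B} {p : B →+* K}

@[simp] lemma fst_dualHom (d : pointDer φ p) (b : B) : (dualHom d b).fst = p b := by simp [dualHom]

@[simp] lemma snd_dualHom (d : pointDer φ p) (b : B) : (dualHom d b).snd = d.1 b := by simp [dualHom]

lemma fstHom_comp_dualHom (d : pointDer φ p) :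
    (TrivSqZeroExt.fstHom K K K).toRingHom.comp (dualHom d) = p :=
  RingHom.ext fun b => fst_dualHom d b

lemma dualHom_comp (d : pointDer φ p) :
    (dualHom d).comp φ = (TrivSqZeroExt.inlHom K K).comp (p.comp φ) := by
  have h := d.2.2.2
  ext a <;> simp [h]

lemma dualHom_comp_eq {ψ : C →+* A} {q : A →+* K} {γ : A →+* B} {φ : C →+* B}
    (d : pointDer φ p) (e : pointDer ψ q) (hq : p.comp γ = q) (h : ∀ a, d.1 (γ a) = e.1 a) :
    (dualHom d).comp γ = dualHom e := by
  ext a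
  · simpa using congr($hq a)
  · simpa using h a

/-- Converse to `dualHom`: the $\varepsilon$-coefficient of a lift of `p` that is constant on the
base is a derivation. -/
lemma snd_mem_pointDer {θ : B →+* DualNumber K}
    (h1 : (TrivSqZeroExt.fstHom K K K).toRingHom.comp θ = p)
    (h2 : θ.comp φ = (TrivSqZeroExt.inlHom K K).comp (p.comp φ)) :
    (fun b => (θ b).snd) ∈ pointDer φ p := by
  have h1' : ∀ b, (θ b).fst = p b := fun b => congr($h1 b)
  refine ⟨fun x y => by simp, fun x y => by simp [h1', mul_comm], fun a => ?_⟩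
  have := congr($h2 a)
  simp only [RingHom.comp_apply] at this
  simp [this]

end

/-- A ramified point has a nonzero relative tangent vector, in terms of charts. -/
lemma exists_pointDer_of_isRamifiedAt {Y Z : Scheme.{u}} (f : Y ⟶ Z) [LocallyOfFiniteType f]
    {A B : CommRingCat.{u}} (h : Spec B ⟶ Y) [IsOpenImmersion h] (j : Spec A ⟶ Z)
    [IsOpenImmersion j] (α : A ⟶ B) (hα : Spec.map α ≫ j = h ≫ f) (b : B ⟶ .of K)
    (x : Spec (.of K)) (hr : IsRamifiedAt f (h (Spec.map b x))) :
    ∃ d ∈ pointDer α.hom b.hom, d ≠ 0 := by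
  have hft : LocallyOfFiniteType (Spec.map α) := by
    have : LocallyOfFiniteType (Spec.map α ≫ j) := hα ▸ inferInstance
    exact locallyOfFiniteType_of_comp _ j
  rw [HasRingHomProperty.Spec_iff (P := @LocallyOfFiniteType)] at hft
  refine exists_pointDer_ne_zero hft b.hom fun g hg hun => hr ?_
  let r : B ⟶ .of (Localization.Away g) := CommRingCat.ofHom (algebraMap _ _)
  have : IsOpenImmersion (Spec.map r) := inferInstanceAs (IsOpenImmersion (Spec.map
    (CommRingCat.ofHom (algebraMap B (Localization.Away g)))))
  have hun' : FormallyUnramified (Spec.map (α ≫ r)) :=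
    (HasRingHomProperty.Spec_iff (P := @FormallyUnramified)).mpr hun
  have hx : Spec.map b x ∈ Set.range (Spec.map r) := by
    have := PrimeSpectrum.localization_away_comap_range (Localization.Away g) g
    refine this.ge ?_
    change ¬ b.hom g ∈ x.asIdeal
    have : x.asIdeal = ⊥ := (Ideal.eq_bot_or_top (K := K) _).resolve_right x.2.ne_top
    rw [this]
    exact hg
  obtain ⟨z, hz⟩ := hx
  have hfac : (Spec.map r ≫ h) ≫ f = Spec.map (α ≫ r) ≫ j := by
    rw [Spec.map_comp, Category.assoc, Category.assoc, hα]
  have := exists_opens_of_openImmersion (P := @FormallyUnramified) (Spec.map r ≫ h) f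
    (by rw [hfac]; exact MorphismProperty.comp_mem _ _ _ hun' inferInstance) z
  simpa [hz] using this

end Tangent

/-! ### Functor of points of the tower and its recursive structure -/

section TowerMaps

variable {X S : Scheme.{u}} (s : X ⟶ S) {Γ : Scheme.{u}} (ι : Γ ⟶ pullback s s)

lemma coord_comp {m : ℕ} (v : Fin (m + 1)) : coord s ι v ≫ s = curveStruct s ι m := by
  rw [coord, Category.assoc, powerCoord_comp, curveStruct]

lemma power_hom_ext {m : ℕ} {T : Scheme.{u}} {a b : T ⟶ power s (m + 1)}
    (h : ∀ v, a ≫ powerCoord s v = b ≫ powerCoord s v) : a = b := by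
  apply WidePullback.hom_ext
  · exact h
  · have := congr($(h 0) ≫ s)
    rwa [Category.assoc, Category.assoc, powerCoord_comp] at this

/-- Because `ι` is a monomorphism, the vertices of a path determine its edges. -/
lemma curve_hom_ext [Mono ι] {m : ℕ} {T : Scheme.{u}} {a b : T ⟶ curve s ι m}
    (h : ∀ v, a ≫ coord s ι v = b ≫ coord s ι v) : a = b := by
  have hb : a ≫ curveEmb s ι m = b ≫ curveEmb s ι m :=
    power_hom_ext s fun v => by simpa [coord] using h v
  apply WidePullback.hom_ext
  · intro e
    rw [← cancel_mono (pullback.snd ι (powerPair s e)), Category.assoc, Category.assoc,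
      WidePullback.π_arrow]
    exact hb
  · exact hb

lemma proj₁_comp : proj₁ s ι ≫ s = proj₂ s ι ≫ s := by
  rw [proj₁, proj₂, Category.assoc, Category.assoc, pullback.condition]

/-- Morphisms to the curve `C_{m+1}` are given by compatible families of morphisms. -/
lemma exists_curve_lift [Mono ι] {m : ℕ} {T : Scheme.{u}} (t : Fin (m + 1) → (T ⟶ X))
    (g : Fin m → (T ⟶ Γ)) (h₁ : ∀ e, g e ≫ proj₁ s ι = t e.castSucc)
    (h₂ : ∀ e, g e ≫ proj₂ s ι = t e.succ) :
    ∃ τ : T ⟶ curve s ι m, (∀ v, τ ≫ coord s ι v = t v) ∧ ∀ e, τ ≫ pairPoint s ι e = g e := by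
  have hs : ∀ v, t v ≫ s = t 0 ≫ s := by
    intro v
    induction v using Fin.induction with
    | zero => rfl
    | succ e ih => rw [← ih, ← h₁, ← h₂, Category.assoc, Category.assoc, proj₁_comp]
  let τ₀ : T ⟶ power s (m + 1) := WidePullback.lift (t 0 ≫ s) t hs
  have hτ₀ : ∀ v, τ₀ ≫ powerCoord s v = t v := fun v => WidePullback.lift_π _ _ _ _ _
  have hpair : ∀ e, g e ≫ ι = τ₀ ≫ powerPair s e := fun e => by
    apply pullback.hom_ext
    · rw [Category.assoc, Category.assoc, powerPair, pullback.lift_fst, hτ₀, ← h₁, proj₁]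
    · rw [Category.assoc, Category.assoc, powerPair, pullback.lift_snd, hτ₀, ← h₂, proj₂]
  let τ : T ⟶ curve s ι m := WidePullback.lift τ₀ (fun e => pullback.lift (g e) τ₀ (hpair e))
    fun e => pullback.lift_snd _ _ _
  have hτ : τ ≫ curveEmb s ι m = τ₀ := WidePullback.lift_base _ _ _ _
  refine ⟨τ, fun v => ?_, fun e => ?_⟩
  · rw [coord, ← Category.assoc, hτ, hτ₀]
  · rw [pairPoint, ← Category.assoc, WidePullback.lift_π, pullback.lift_fst]

/-- The curve `C_{m+2}` is the fibre product of `C_{m+1}` and `Γ` over `X`. -/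
lemma exists_isPullback_curve [Mono ι] (m : ℕ) :
    ∃ r : curve s ι (m + 1) ⟶ curve s ι m,
      (∀ v : Fin (m + 1), r ≫ coord s ι v = coord s ι v.castSucc) ∧
      (∀ e : Fin m, r ≫ pairPoint s ι e = pairPoint s ι e.castSucc) ∧
      IsPullback r (pairPoint s ι (Fin.last m)) (coord s ι (Fin.last m)) (proj₁ s ι) := by
  obtain ⟨r, hr₁, hr₂⟩ := exists_curve_lift s ι
    (fun v : Fin (m + 1) => coord s ι (m := m + 1) v.castSucc)
    (fun e : Fin m => pairPoint s ι (m := m + 1) e.castSucc)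
    (fun e => pairPoint_proj₁ s ι _) (fun e => by rw [pairPoint_proj₂, Fin.succ_castSucc])
  refine ⟨r, hr₁, hr₂, ⟨by rw [hr₁, pairPoint_proj₁]⟩, ⟨?_⟩⟩
  have key (c : PullbackCone (coord s ι (Fin.last m)) (proj₁ s ι)) :
      ∃ τ : c.pt ⟶ curve s ι (m + 1), τ ≫ r = c.fst ∧ τ ≫ pairPoint s ι (Fin.last m) = c.snd := by
    obtain ⟨τ, h₁, h₂⟩ := exists_curve_lift s ι (m := m + 1)
      -- The path is prolonged by the new edge, whose endpoint under $\pi_2$ is the new vertex.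
      (Fin.snoc (α := fun _ => c.pt ⟶ X) (fun v => c.fst ≫ coord s ι v) (c.snd ≫ proj₂ s ι))
      (Fin.snoc (α := fun _ => c.pt ⟶ Γ) (fun e => c.fst ≫ pairPoint s ι e) c.snd)
      (by
        intro e
        induction e using Fin.lastCases with
        | last => simp only [Fin.snoc_last, Fin.snoc_castSucc]; exact c.condition.symm
        | cast e => simp only [Fin.snoc_castSucc, Category.assoc, pairPoint_proj₁])
      (by
        intro e
        induction e using Fin.lastCases with
        | last => simp only [Fin.snoc_last, Fin.succ_last]
        | cast e => simp only [Fin.snoc_castSucc, Category.assoc, pairPoint_proj₂,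
            Fin.succ_castSucc])
    refine ⟨τ, curve_hom_ext s ι fun v => ?_, ?_⟩
    · rw [Category.assoc, hr₁, h₁, Fin.snoc_castSucc]
    · rw [h₂, Fin.snoc_last]
  choose L hL₁ hL₂ using key
  refine PullbackCone.IsLimit.mk _ L hL₁ hL₂ fun c l hl₁ hl₂ => curve_hom_ext s ι fun v => ?_
  induction v using Fin.lastCases with
  | last => rw [← Fin.succ_last, ← pairPoint_proj₂, ← Category.assoc, ← Category.assoc, hl₂, hL₂]
  | cast v => rw [← hr₁, ← Category.assoc, ← Category.assoc, hl₁, hL₁]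

end TowerMaps

/-! ### Smooth points of the tower -/

section Smoothness

lemma IsEtaleAt.of_isPullback {Y' Y Z' Z : Scheme.{u}} {f' : Y' ⟶ Z'} {g' : Y' ⟶ Y} {g : Z' ⟶ Z}
    {f : Y ⟶ Z} (h : IsPullback f' g' g f) {y : Y'} (hf : IsEtaleAt f (g' y)) :
    IsEtaleAt f' y := by
  obtain ⟨U, hy, hU⟩ := hf
  refine ⟨g' ⁻¹ᵁ U, hy, ?_⟩
  have h1 := (isPullback_morphismRestrict g' U).paste_vert h.flip
  exact MorphismProperty.of_isPullback (P := @Etale) h1 hU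

lemma exists_opens_comp_of_isEtaleAt {P : MorphismProperty Scheme.{u}}
    (hP : ∀ {A B C : Scheme.{u}} (a : A ⟶ B) (b : B ⟶ C), Etale a → P b → P (a ≫ b))
    {Y Z W : Scheme.{u}} {f : Y ⟶ Z} {g : Z ⟶ W} {y : Y} (hf : IsEtaleAt f y)
    (hg : ∃ V : Z.Opens, f y ∈ V ∧ P (V.ι ≫ g)) : ∃ U : Y.Opens, y ∈ U ∧ P (U.ι ≫ f ≫ g) := by
  obtain ⟨U, hyU, hU⟩ := hf
  obtain ⟨V, hyV, hV⟩ := hg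
  let O : Y.Opens := U ⊓ f ⁻¹ᵁ V
  have hrange : Set.range (O.ι ≫ f) ⊆ Set.range V.ι := by
    rw [Scheme.Opens.range_ι]
    rintro _ ⟨x, rfl⟩
    rw [Scheme.Hom.comp_apply]
    exact x.2.2
  let l := IsOpenImmersion.lift V.ι (O.ι ≫ f) hrange
  have hl : l ≫ V.ι = O.ι ≫ f := IsOpenImmersion.lift_fac _ _ _
  have hO : Etale (l ≫ V.ι) := by
    rw [hl, ← Scheme.homOfLE_ι (X := Y) (U := O) (V := U) inf_le_left, Category.assoc]
    infer_instance
  refine ⟨O, ⟨hyU, hyV⟩, ?_⟩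
  rw [← Category.assoc, ← hl, Category.assoc]
  exact hP _ _ (Etale.of_comp l V.ι) hV

lemma IsEtaleAt.comp {Y Z W : Scheme.{u}} {f : Y ⟶ Z} {g : Z ⟶ W} {y : Y} (hf : IsEtaleAt f y)
    (hg : IsEtaleAt g (f y)) : IsEtaleAt (f ≫ g) y :=
  exists_opens_comp_of_isEtaleAt (P := @Etale) (fun _ _ _ _ => inferInstance) hf hg

lemma not_isSingularPoint_comp {Y Z W : Scheme.{u}} {f : Y ⟶ Z} {g : Z ⟶ W} {y : Y}
    (hf : IsEtaleAt f y) (hg : ¬ IsSingularPoint g (f y)) : ¬ IsSingularPoint (f ≫ g) y :=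
  not_not.mpr (exists_opens_comp_of_isEtaleAt (P := @Smooth) (fun _ _ _ _ => inferInstance) hf
    (not_not.mp hg))

variable {X S : Scheme.{u}} (s : X ⟶ S) {Γ : Scheme.{u}} (ι : Γ ⟶ pullback s s)

lemma isIso_coord_zero [Mono ι] : IsIso (coord s ι (0 : Fin (0 + 1))) := by
  obtain ⟨τ, hτ, -⟩ := exists_curve_lift s ι (m := 0) (fun _ => 𝟙 X) Fin.elim0
    (fun e => e.elim0) (fun e => e.elim0)
  refine ⟨τ, curve_hom_ext s ι fun v => ?_, hτ _⟩
  rw [Category.assoc, hτ, Category.comp_id, Category.id_comp, Fin.eq_zero v]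

/-- The last coordinate is the last edge followed by $\pi_2$, and the last-edge map to $\Gamma$ is a
base change of the last coordinate one level below. -/
lemma isEtaleAt_coord_last [Mono ι] {m : ℕ} (P : curve s ι m)
    (h : ∀ e, IsEtaleAt (proj₂ s ι) (pairPoint s ι e P)) :
    IsEtaleAt (coord s ι (Fin.last m)) P := by
  induction m with
  | zero =>
    have : IsIso (coord s ι (Fin.last 0)) := isIso_coord_zero s ι
    exact ⟨⊤, trivial, inferInstance⟩
  | succ m ih =>
    obtain ⟨r, hr₁, hr₂, hr⟩ := exists_isPullback_curve s ι m
    rw [← Fin.succ_last, ← pairPoint_proj₂]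
    refine IsEtaleAt.comp (IsEtaleAt.of_isPullback hr.flip (ih (r P) fun e => ?_)) (h _)
    rw [← Scheme.Hom.comp_apply, hr₂]
    exact h _

lemma not_isSingularPoint_of_forall [Mono ι] [Smooth s] {m : ℕ} (P : curve s ι m)
    (h : ∀ i j : Fin m, i ≤ j → IsEtaleAt (proj₂ s ι) (pairPoint s ι i P) ∨
      IsEtaleAt (proj₁ s ι) (pairPoint s ι j P)) :
    ¬ IsSingularPoint (curveStruct s ι m) P := by
  have hs : ∀ x, ¬ IsSingularPoint s x := fun x => not_not.mpr ⟨⊤, trivial, inferInstance⟩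
  have key (m : ℕ) (P : curve s ι m) (h₂ : ∀ e, IsEtaleAt (proj₂ s ι) (pairPoint s ι e P)) :
      ¬ IsSingularPoint (curveStruct s ι m) P := by
    rw [← coord_comp s ι (Fin.last m)]
    exact not_isSingularPoint_comp (isEtaleAt_coord_last s ι P h₂) (hs _)
  induction m with
  | zero => exact key 0 P fun e => e.elim0
  | succ m ih =>
    by_cases hlast : IsEtaleAt (proj₁ s ι) (pairPoint s ι (Fin.last m) P)
    · obtain ⟨r, hr₁, hr₂, hr⟩ := exists_isPullback_curve s ι m
      rw [← coord_comp s ι (Fin.castSucc 0), ← hr₁, Category.assoc, coord_comp]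
      refine not_isSingularPoint_comp (IsEtaleAt.of_isPullback hr hlast) (ih _ fun i j hij => ?_)
      rw [← Scheme.Hom.comp_apply, ← Scheme.Hom.comp_apply, hr₂, hr₂]
      exact h _ _ (Fin.castSucc_le_castSucc_iff.mpr hij)
    -- Every edge precedes or equals the last one, so failure of $\pi_1$ there forces $\pi_2$ to be
    -- étale at all edges.
    · exact key _ P fun e => (h e _ (Fin.le_last e)).resolve_right hlast

/-- The first coordinate is a composite of base changes of $\pi_1$. This is what bounds the
dimension of a smooth neighbourhood by one. -/
lemma locallyQuasiFinite_coord_zero [Mono ι] [LocallyQuasiFinite (proj₁ s ι)] (m : ℕ) :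
    LocallyQuasiFinite (coord s ι (0 : Fin (m + 1))) := by
  induction m with
  | zero =>
    have := isIso_coord_zero s ι
    infer_instance
  | succ m ih =>
    obtain ⟨r, hr₁, hr₂, hr⟩ := exists_isPullback_curve s ι m
    have : LocallyQuasiFinite r :=
      MorphismProperty.of_isPullback (P := @LocallyQuasiFinite) hr.flip inferInstance
    rw [← Fin.castSucc_zero, ← hr₁]
    infer_instance

end Smoothness

lemma exists_affine_chart {Y : Scheme.{u}} (U : Y.Opens) (y : Y) (hy : y ∈ U) :
    ∃ (R : CommRingCat.{u}) (j : Spec R ⟶ Y), IsOpenImmersion j ∧ y ∈ Set.range j ∧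
      ∀ x, j x ∈ U := by
  obtain ⟨_, ⟨V, hV, rfl⟩, hyV, hVU⟩ :=
    Y.isBasis_affineOpens.exists_subset_of_mem_open hy U.isOpen
  replace hV : IsAffineOpen V := hV
  refine ⟨Γ(Y, V), hV.fromSpec, inferInstance, ?_, fun x => hVU ?_⟩
  · rw [hV.range_fromSpec]; exact hyV
  · rw [← hV.range_fromSpec]; exact ⟨x, rfl⟩

/-- A field-valued point, or a tangent vector, factors through every chart at its image. -/
lemma exists_lift_chart {A B : CommRingCat.{u}} {Y : Scheme.{u}} (j : Spec A ⟶ Y)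
    [IsOpenImmersion j] (t : Spec B ⟶ Y) (h : ∀ x, t x ∈ Set.range j) :
    ∃ a : A ⟶ B, Spec.map a ≫ j = t := by
  have hr : Set.range t ⊆ Set.range j := by rintro _ ⟨x, rfl⟩; exact h x
  obtain ⟨a, ha⟩ := Spec.map_surjective (IsOpenImmersion.lift j t hr)
  exact ⟨a, by rw [ha, IsOpenImmersion.lift_fac]⟩

lemma eq_of_map_comp_eq {A B : CommRingCat.{u}} {Y : Scheme.{u}} (j : Spec A ⟶ Y)
    [IsOpenImmersion j] {a a' : A ⟶ B} (h : Spec.map a ≫ j = Spec.map a' ≫ j) : a = a' :=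
  Spec.map_injective ((cancel_mono j).mp h)

/-! ### Tangent space of the correspondence at an edge -/

section Edge

variable {K : Type u} [Field K]

/-- The tangent vector of a scheme given by a derivation at a point of a chart. -/
noncomputable def tangent {k A : CommRingCat.{u}} {φ : k ⟶ A} {a : A ⟶ .of K} {Y : Scheme.{u}}
    (j : Spec A ⟶ Y) (d : pointDer φ.hom a.hom) : Spec (.of (DualNumber K)) ⟶ Y :=
  Spec.map (CommRingCat.ofHom (dualHom d)) ≫ j

lemma dualPoint_tangent {k A : CommRingCat.{u}} {φ : k ⟶ A} {a : A ⟶ .of K} {Y : Scheme.{u}}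
    (j : Spec A ⟶ Y) (d : pointDer φ.hom a.hom) : dualPoint K ≫ tangent j d = Spec.map a ≫ j := by
  rw [tangent, dualPoint, ← Category.assoc, ← Spec.map_comp, ← CommRingCat.ofHom_comp,
    fstHom_comp_dualHom, CommRingCat.ofHom_hom]

lemma tangent_comp {k A B : CommRingCat.{u}} {φ : k ⟶ A} {a : A ⟶ .of K} {ψ : k ⟶ B}
    {b : B ⟶ .of K} {Y Z : Scheme.{u}} {j : Spec A ⟶ Y} {h : Spec B ⟶ Z} {f : Z ⟶ Y} {α : A ⟶ B}
    (hα : Spec.map α ≫ j = h ≫ f) (hb : α ≫ b = a) {d : pointDer ψ.hom b.hom}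
    {e : pointDer φ.hom a.hom} (hde : ∀ x, d.1 (α.hom x) = e.1 x) :
    tangent h d ≫ f = tangent j e := by
  rw [tangent, tangent, Category.assoc, ← hα, ← Category.assoc, ← Spec.map_comp]
  congr 2
  apply CommRingCat.hom_ext
  exact dualHom_comp_eq d e congr(($hb).hom) hde

variable {k : CommRingCat.{u}} {X : Scheme.{u}} (s : X ⟶ Spec k) {Γ : Scheme.{u}}
  (ι : Γ ⟶ pullback s s) (q : Spec (.of K) ⟶ Γ) {A A' : CommRingCat.{u}} {φ : k ⟶ A} {φ' : k ⟶ A'}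
  {a : A ⟶ .of K} {a' : A' ⟶ .of K} {j : Spec A ⟶ X} {j' : Spec A' ⟶ X}
  [IsOpenImmersion j] [IsOpenImmersion j']

/-- The tangent vectors of `Γ` that are visible in a chart of `Γ`. -/
lemma exists_edge_submodule [Mono ι] [LocallyOfFiniteType (proj₁ s ι)]
    [LocallyOfFiniteType (proj₂ s ι)]
    (hj : j ≫ s = Spec.map φ) (hj' : j' ≫ s = Spec.map φ')
    (ha : Spec.map a ≫ j = q ≫ proj₁ s ι) (ha' : Spec.map a' ≫ j' = q ≫ proj₂ s ι)
    (E : pointDer φ.hom a.hom ≃ₗ[K] K) (E' : pointDer φ'.hom a'.hom ≃ₗ[K] K)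
    {B : CommRingCat.{u}} (h : Spec B ⟶ Γ) [IsOpenImmersion h] (hq : ∀ x, q x ∈ Set.range h)
    (h₁ : ∀ x, proj₁ s ι (h x) ∈ Set.range j) (h₂ : ∀ x, proj₂ s ι (h x) ∈ Set.range j')
    (x : Spec (.of K)) :
    ∃ M : Submodule K (K × K),
      (∀ z ∈ M, ∃ g : Spec (.of (DualNumber K)) ⟶ Γ,
        g ≫ proj₁ s ι = tangent j (E.symm z.1) ∧ g ≫ proj₂ s ι = tangent j' (E'.symm z.2)) ∧
      (IsRamifiedAt (proj₂ s ι) (q x) → ∃ u ≠ 0, (u, 0) ∈ M) ∧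
      (IsRamifiedAt (proj₁ s ι) (q x) → ∃ v ≠ 0, (0, v) ∈ M) ∧
      ∀ ψ : k ⟶ B, h ≫ proj₁ s ι ≫ s = Spec.map ψ →
        ψ.hom.IsStandardSmoothOfRelativeDimension 1 → M ≠ ⊥ := by
  obtain ⟨b, hb⟩ := exists_lift_chart h q hq
  obtain ⟨α, hα⟩ := exists_lift_chart j (h ≫ proj₁ s ι) (fun x => by simpa using h₁ x)
  obtain ⟨β, hβ⟩ := exists_lift_chart j' (h ≫ proj₂ s ι) (fun x => by simpa using h₂ x)
  have hαb : α ≫ b = a := eq_of_map_comp_eq j (by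
    rw [Spec.map_comp, Category.assoc, hα, ha, ← Category.assoc, hb])
  have hβb : β ≫ b = a' := eq_of_map_comp_eq j' (by
    rw [Spec.map_comp, Category.assoc, hβ, ha', ← Category.assoc, hb])
  have hαβ : φ ≫ α = φ' ≫ β := Spec.map_injective (by
    rw [Spec.map_comp, Spec.map_comp, ← hj, ← hj', ← Category.assoc, ← Category.assoc, hα, hβ,
      Category.assoc, Category.assoc, proj₁_comp])
  subst hαb hβb
  let R₁ : pointDer (φ ≫ α).hom b.hom →ₗ[K] pointDer φ.hom (α ≫ b).hom :=
    pointDerRestrict α.hom b.hom rfl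
  let R₂ : pointDer (φ ≫ α).hom b.hom →ₗ[K] pointDer φ'.hom (β ≫ b).hom :=
    pointDerRestrict β.hom b.hom congr(($hαβ).hom)
  have hR₁ : ∀ d x, (R₁ d).1 x = d.1 (α.hom x) := fun d x => rfl
  have hR₂ : ∀ d x, (R₂ d).1 x = d.1 (β.hom x) := fun d x => rfl
  let L : pointDer (φ ≫ α).hom b.hom →ₗ[K] K × K :=
    (E.toLinearMap ∘ₗ R₁).prod (E'.toLinearMap ∘ₗ R₂)
  have hL : ∀ d, L d = (E (R₁ d), E' (R₂ d)) := fun d => rfl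
  have ht₁ : ∀ d, tangent h d ≫ proj₁ s ι = tangent j (R₁ d) := fun d =>
    tangent_comp hα rfl fun x => (hR₁ d x).symm
  have ht₂ : ∀ d, tangent h d ≫ proj₂ s ι = tangent j' (R₂ d) := fun d =>
    tangent_comp hβ rfl fun x => (hR₂ d x).symm
  -- A tangent vector of `Γ` is determined by its two projections, again because `ι` is a
  -- monomorphism.
  have hinj : ∀ d, L d = 0 → d = 0 := by
    intro d hd
    rw [hL, Prod.mk_eq_zero, E.map_eq_zero_iff, E'.map_eq_zero_iff] at hd
    have : tangent h d = tangent h (0 : pointDer (φ ≫ α).hom b.hom) := by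
      rw [← cancel_mono ι]
      apply pullback.hom_ext
      · have := (ht₁ d).trans ((congrArg (tangent j) (by rw [hd.1, map_zero])).trans (ht₁ 0).symm)
        simpa [proj₁] using this
      · have := (ht₂ d).trans ((congrArg (tangent j') (by rw [hd.2, map_zero])).trans (ht₂ 0).symm)
        simpa [proj₂] using this
    have := eq_of_map_comp_eq h this
    ext x
    simpa using congr(TrivSqZeroExt.snd (($this).hom x))
  refine ⟨LinearMap.range L, ?_, ?_, ?_, ?_⟩
  · rintro _ ⟨d, rfl⟩
    exact ⟨tangent h d, by rw [ht₁]; simp [hL], by rw [ht₂]; simp [hL]⟩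
  · intro hr
    rw [← hb, Scheme.Hom.comp_apply] at hr
    obtain ⟨d, hd, hd0⟩ := exists_pointDer_of_isRamifiedAt (proj₂ s ι) h j' β hβ b x hr
    -- A derivation vanishing on the target chart of $\pi_2$ vanishes on `k`, so it is a tangent
    -- vector of `Γ` with second component zero; injectivity of `L` makes the first component
    -- nonzero.
    let d' : pointDer (φ ≫ α).hom b.hom := ⟨d, hd.1, hd.2.1, fun c => by
      rw [hαβ]; exact hd.2.2 _⟩
    have h2 : R₂ d' = 0 := by
      ext y
      rw [hR₂]; exact hd.2.2 y
    have hLd : L d' = (E (R₁ d'), 0) := by rw [hL, h2, map_zero]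
    refine ⟨E (R₁ d'), fun h1 => hd0 ?_, ⟨d', hLd⟩⟩
    have := hinj d' (by rw [hLd, h1]; rfl)
    exact congrArg Subtype.val this
  · intro hr
    rw [← hb, Scheme.Hom.comp_apply] at hr
    obtain ⟨d, hd, hd0⟩ := exists_pointDer_of_isRamifiedAt (proj₁ s ι) h j α hα b x hr
    let d' : pointDer (φ ≫ α).hom b.hom := ⟨d, hd.1, hd.2.1, fun c => hd.2.2 _⟩
    have h2 : R₁ d' = 0 := by
      ext y
      rw [hR₁]; exact hd.2.2 y
    have hLd : L d' = (0, E' (R₂ d')) := by rw [hL, h2, map_zero]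
    refine ⟨E' (R₂ d'), fun h1 => hd0 ?_, ⟨d', hLd⟩⟩
    have := hinj d' (by rw [hLd, h1]; rfl)
    exact congrArg Subtype.val this
  · intro ψ hψ hsm hM
    have : ψ = φ ≫ α := Spec.map_injective (by
      rw [← hψ, Spec.map_comp, ← hj, ← Category.assoc, ← Category.assoc, hα])
    subst this
    obtain ⟨e⟩ := nonempty_pointDer_equiv hsm b.hom
    have h0 := hinj (e.symm 1) (by
      rw [LinearMap.range_eq_bot] at hM
      rw [hM, LinearMap.zero_apply])
    rw [e.symm.map_eq_zero_iff] at h0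
    exact one_ne_zero h0

end Edge

/-! ### One linear equation per edge -/

section EdgeEquation

/-- A nonzero `M` contains a line, and the equation of that line is used, with an axis chosen if `M`
contains just one. If `M` contains both axes, the zero equation is allowed. Only the inclusion of
the solutions in `M` is needed, since the tangent space is bounded from below. -/
lemma exists_linear_equation {K : Type*} [Field K] (M : Submodule K (K × K)) (hM : M ≠ ⊥) :
    ∃ x y : K, ((∃ u ≠ 0, (u, (0 : K)) ∈ M) → x = 0) ∧ ((∃ v ≠ 0, ((0 : K), v) ∈ M) → y = 0) ∧
      ∀ z z', x * z + y * z' = 0 → (z, z') ∈ M := by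
  by_cases h₁ : ∃ u ≠ 0, (u, (0 : K)) ∈ M
  · have h₁' : ∀ z, (z, (0 : K)) ∈ M := by
      obtain ⟨u, hu, hu'⟩ := h₁
      intro z
      simpa [hu] using M.smul_mem (z / u) hu'
    by_cases h₂ : ∃ v ≠ 0, ((0 : K), v) ∈ M
    · obtain ⟨v, hv, hv'⟩ := h₂
      refine ⟨0, 0, fun _ => rfl, fun _ => rfl, fun z z' _ => ?_⟩
      simpa [hv] using M.add_mem (h₁' z) (M.smul_mem (z' / v) hv')
    · refine ⟨0, 1, fun _ => rfl, fun h => absurd h h₂, fun z z' h => ?_⟩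
      obtain rfl : z' = 0 := by simpa using h
      exact h₁' z
  · by_cases h₂ : ∃ v ≠ 0, ((0 : K), v) ∈ M
    · obtain ⟨v, hv, hv'⟩ := h₂
      refine ⟨1, 0, fun h => absurd h h₁, fun _ => rfl, fun z z' h => ?_⟩
      obtain rfl : z = 0 := by simpa using h
      simpa [hv] using M.smul_mem (z' / v) hv'
    · obtain ⟨⟨p, r⟩, hpr, hne⟩ := M.ne_bot_iff.mp hM
      refine ⟨r, -p, fun h => absurd h h₁, fun h => absurd h h₂, fun z z' h => ?_⟩
      by_cases hp : p = 0
      · subst hp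
        exact absurd ⟨r, fun hr => hne (by simp [hr]), hpr⟩ h₂
      · have := M.smul_mem (z / p) hpr
        have hz : z / p * r = z' := by field_simp; linear_combination h
        simpa [hp, hz] using this

lemma smoothOfRelativeDimension_one_comp_of_etale {X Y S : Scheme.{u}} (f : Y ⟶ X) (s : X ⟶ S)
    [Etale f] [SmoothOfRelativeDimension 1 s] : SmoothOfRelativeDimension 1 (f ≫ s) := by
  have : SmoothOfRelativeDimension 0 f := (Etale.iff_smoothOfRelativeDimension_zero f).mp ‹_›
  have h := smoothOfRelativeDimension_comp 0 1 f s
  rwa [zero_add] at h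

variable {K : Type u} [Field K] {k : CommRingCat.{u}} {X : Scheme.{u}} (s : X ⟶ Spec k)
  {Γ : Scheme.{u}} (ι : Γ ⟶ pullback s s) (q : Spec (.of K) ⟶ Γ) {A A' : CommRingCat.{u}}
  {φ : k ⟶ A} {φ' : k ⟶ A'} {a : A ⟶ .of K} {a' : A' ⟶ .of K} {j : Spec A ⟶ X} {j' : Spec A' ⟶ X}
  [IsOpenImmersion j] [IsOpenImmersion j']

/-- The linear equation satisfied by the tangent vectors of the correspondence at a point. -/
lemma exists_edge_equation [Mono ι] [SmoothOfRelativeDimension 1 s]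
    [Flat (proj₁ s ι)] [LocallyOfFinitePresentation (proj₁ s ι)]
    [Flat (proj₂ s ι)] [LocallyOfFinitePresentation (proj₂ s ι)]
    (hj : j ≫ s = Spec.map φ) (hj' : j' ≫ s = Spec.map φ')
    (ha : Spec.map a ≫ j = q ≫ proj₁ s ι) (ha' : Spec.map a' ≫ j' = q ≫ proj₂ s ι)
    (E : pointDer φ.hom a.hom ≃ₗ[K] K) (E' : pointDer φ'.hom a'.hom ≃ₗ[K] K)
    (p : Γ) (hp : ∀ x, q x = p) :
    ∃ x y : K, (¬ IsEtaleAt (proj₂ s ι) p → x = 0) ∧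
      (¬ IsEtaleAt (proj₁ s ι) p → y = 0) ∧
      ∀ z z', x * z + y * z' = 0 → ∃ g : Spec (.of (DualNumber K)) ⟶ Γ,
        g ≫ proj₁ s ι = tangent j (E.symm z) ∧ g ≫ proj₂ s ι = tangent j' (E'.symm z') := by
  let x₀ : Spec (.of K) := ⟨⊥, Ideal.isPrime_bot⟩
  have hpx := hp x₀
  let W : Γ.Opens := proj₁ s ι ⁻¹ᵁ j.opensRange ⊓ proj₂ s ι ⁻¹ᵁ j'.opensRange
  have hpW : p ∈ W := by
    subst hpx
    refine ⟨⟨Spec.map a x₀, ?_⟩, ⟨Spec.map a' x₀, ?_⟩⟩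
    · rw [← Scheme.Hom.comp_apply, ha, Scheme.Hom.comp_apply]
    · rw [← Scheme.Hom.comp_apply, ha', Scheme.Hom.comp_apply]
  rw [isEtaleAt_iff_not_isRamifiedAt, isEtaleAt_iff_not_isRamifiedAt, not_not, not_not]
  have hchart (B : CommRingCat.{u}) (h : Spec B ⟶ Γ) (_ : IsOpenImmersion h)
      (hph : p ∈ Set.range h) (hhW : ∀ x, h x ∈ W) :=
    exists_edge_submodule s ι q hj hj' ha ha' E E' h (fun x => by rw [hp]; exact hph)
      (fun x => (hhW x).1) (fun x => (hhW x).2) x₀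
  rw [hpx] at hchart
  have hsm {f : Γ ⟶ X} (hf : f ≫ s = proj₁ s ι ≫ s) (he : IsEtaleAt f p) :
      ∃ (B : CommRingCat.{u}) (h : Spec B ⟶ Γ) (ψ : k ⟶ B), IsOpenImmersion h ∧
        p ∈ Set.range h ∧ (∀ x, h x ∈ W) ∧ h ≫ proj₁ s ι ≫ s = Spec.map ψ ∧
        ψ.hom.IsStandardSmoothOfRelativeDimension 1 := by
    obtain ⟨U, hpU, hU⟩ := he
    have hUs : SmoothOfRelativeDimension 1 ((U ⊓ W).ι ≫ f ≫ s) := by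
      rw [← Scheme.homOfLE_ι (X := Γ) (U := U ⊓ W) (V := U) inf_le_left]
      have : Etale ((Γ.homOfLE (inf_le_left : U ⊓ W ≤ U) ≫ U.ι) ≫ f) := by
        rw [Category.assoc]; infer_instance
      rw [← Category.assoc]
      exact smoothOfRelativeDimension_one_comp_of_etale _ s
    rw [hf] at hUs
    obtain ⟨B, h, ψ, h1, h2, h3, h4, h5⟩ := exists_chart (P := @SmoothOfRelativeDimension 1)
      (proj₁ s ι ≫ s) (U ⊓ W) hUs p ⟨hpU, hpW⟩
    exact ⟨B, h, ψ, h1, h2, fun x => (h3 x).2, h4, h5⟩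
  -- If one projection is unramified at `p`, it is étale there, so `Γ` is smooth of dimension one
  -- and has a nonzero tangent vector. If both are ramified, ramification itself supplies one.
  have key : ∃ M : Submodule K (K × K), M ≠ ⊥ ∧
      (∀ z ∈ M, ∃ g : Spec (.of (DualNumber K)) ⟶ Γ,
        g ≫ proj₁ s ι = tangent j (E.symm z.1) ∧ g ≫ proj₂ s ι = tangent j' (E'.symm z.2)) ∧
      (IsRamifiedAt (proj₂ s ι) p → ∃ u ≠ 0, (u, 0) ∈ M) ∧
      (IsRamifiedAt (proj₁ s ι) p → ∃ v ≠ 0, (0, v) ∈ M) := by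
    by_cases h₁ : IsRamifiedAt (proj₁ s ι) p
    · by_cases h₂ : IsRamifiedAt (proj₂ s ι) p
      · obtain ⟨B, h, hh, hph, hhW⟩ := exists_affine_chart W p hpW
        obtain ⟨M, hM₁, hM₂, hM₃, -⟩ := hchart B h hh hph hhW
        refine ⟨M, fun hM => ?_, hM₁, hM₂, hM₃⟩
        obtain ⟨v, hv, hv'⟩ := hM₃ h₁
        exact hv (by simpa [hM] using hv')
      · obtain ⟨B, h, ψ, hh, hph, hhW, hψ, hψ'⟩ := hsm (proj₁_comp s ι).symm
          ((isEtaleAt_iff_not_isRamifiedAt _ _).mpr h₂)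
        obtain ⟨M, hM₁, hM₂, hM₃, hM₄⟩ := hchart B h hh hph hhW
        exact ⟨M, hM₄ ψ hψ hψ', hM₁, hM₂, hM₃⟩
    · obtain ⟨B, h, ψ, hh, hph, hhW, hψ, hψ'⟩ := hsm rfl
        ((isEtaleAt_iff_not_isRamifiedAt _ _).mpr h₁)
      obtain ⟨M, hM₁, hM₂, hM₃, hM₄⟩ := hchart B h hh hph hhW
      exact ⟨M, hM₄ ψ hψ hψ', hM₁, hM₂, hM₃⟩
  obtain ⟨M, hM, hM₁, hM₂, hM₃⟩ := key
  obtain ⟨x, y, hx, hy, hxy⟩ := exists_linear_equation M hM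
  exact ⟨x, y, fun h => hx (hM₂ h), fun h => hy (hM₃ h), fun z z' h => hM₁ (z, z') (hxy z z' h)⟩

end EdgeEquation

/-! ### Singular points of the tower -/

section Converse

instance : HasRingHomProperty @Smooth.{u} (RingHom.Locally RingHom.IsStandardSmooth) := by
  convert! (inferInstance : HasRingHomProperty (@Smooth.{u}) RingHom.Smooth)
  ext f
  rw [RingHom.smooth_iff_locally_isStandardSmooth]

lemma exists_isStandardSmoothOfRelativeDimension {R S : Type*} [CommRing R] [CommRing S]
    {f : R →+* S} (hf : f.IsStandardSmooth) : ∃ n, f.IsStandardSmoothOfRelativeDimension n := by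
  obtain ⟨_, _, _, _, ⟨P⟩⟩ := hf
  let := f.toAlgebra
  exact ⟨_, _, _, _, ‹_›, P, rfl⟩

variable {k : Type u} [Field k] {X : Scheme.{u}} (s : X ⟶ Spec (.of k)) {Γ : Scheme.{u}}
  (ι : Γ ⟶ pullback s s)

lemma isSingularPoint_of_not_isEtaleAt [Mono ι] [SmoothOfRelativeDimension 1 s]
    [Flat (proj₁ s ι)] [LocallyOfFinitePresentation (proj₁ s ι)]
    [Flat (proj₂ s ι)] [LocallyOfFinitePresentation (proj₂ s ι)]
    [LocallyQuasiFinite (proj₁ s ι)] {m : ℕ} (P : curve s ι m) {i₀ j₀ : Fin m} (hij : i₀ ≤ j₀)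
    (hi : ¬ IsEtaleAt (proj₂ s ι) (pairPoint s ι i₀ P))
    (hj : ¬ IsEtaleAt (proj₁ s ι) (pairPoint s ι j₀ P)) :
    IsSingularPoint (curveStruct s ι m) P := by
  rintro ⟨U, hPU, hU⟩
  obtain ⟨K, _, q, hq⟩ : ∃ (K : Type u) (_ : Field K) (q : Spec (.of K) ⟶ curve s ι m),
      ∀ x, q x = P :=
    ⟨(curve s ι m).residueField P, inferInstance, (curve s ι m).fromSpecResidueField P,
      fun x => Scheme.fromSpecResidueField_apply P x⟩
  choose A j φ hjo hPj _ hjs hφ using fun v : Fin (m + 1) =>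
    exists_chart (P := @SmoothOfRelativeDimension 1) s ⊤
      (smoothOfRelativeDimension_one_comp_of_etale _ s) (coord s ι v P) trivial
  let W : (curve s ι m).Opens := U ⊓ ⟨⋂ v, coord s ι v ⁻¹' Set.range (j v),
    isOpen_iInter_of_finite fun v =>
      (j v).isOpenEmbedding.isOpen_range.preimage (coord s ι v).continuous⟩
  have hPW : P ∈ W := ⟨hPU, Set.mem_iInter.mpr hPj⟩
  obtain ⟨R, c, φR, hc, hPc, hcW, hcs, hφR⟩ := exists_chart (P := @Smooth)
    (Q := RingHom.IsStandardSmooth) (curveStruct s ι m) W (by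
      rw [← Scheme.homOfLE_ι (X := curve s ι m) (U := W) (V := U) inf_le_left, Category.assoc]
      infer_instance) P hPW
  obtain ⟨ρ, hρ⟩ := exists_lift_chart c q (fun x => by rw [hq]; exact hPc)
  choose γ hγ using fun v => exists_lift_chart (j v) (c ≫ coord s ι v)
    (fun x => by simpa using Set.mem_iInter.mp (hcW x).2 v)
  have hφγ : ∀ v, φR = φ v ≫ γ v := fun v => Spec.map_injective (by
    rw [Spec.map_comp, ← hjs, ← Category.assoc, hγ, Category.assoc, coord_comp, hcs])
  have ha : ∀ v, Spec.map (γ v ≫ ρ) ≫ j v = q ≫ coord s ι v := fun v => by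
    rw [Spec.map_comp, Category.assoc, hγ, ← Category.assoc, hρ]
  let E : ∀ v, pointDer (φ v).hom (γ v ≫ ρ).hom ≃ₗ[K] K := fun v =>
    (nonempty_pointDer_equiv (hφ v) (γ v ≫ ρ).hom).some.trans (LinearEquiv.funUnique (Fin 1) K K)
  choose α β hα hβ hαβ using fun e : Fin m => exists_edge_equation s ι
    (q ≫ pairPoint s ι e) (hjs e.castSucc) (hjs e.succ)
    (by rw [ha, Category.assoc, pairPoint_proj₁]) (by rw [ha, Category.assoc, pairPoint_proj₂])
    (E e.castSucc) (E e.succ) (pairPoint s ι e P) (fun x => by rw [Scheme.Hom.comp_apply, hq])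
  let L : pointDer φR.hom ρ.hom →ₗ[K] (Fin (m + 1) → K) := LinearMap.pi fun v =>
    (E v).toLinearMap ∘ₗ pointDerRestrict (γ v).hom ρ.hom congr(($(hφγ v)).hom)
  -- A solution gives compatible tangent vectors at all vertices and edges, which glue to a map from
  -- the dual numbers to the curve; its $\varepsilon$-part is a derivation at `P`.
  have hker : LinearMap.ker (bidiagonal α β) ≤ LinearMap.range L := by
    intro z hz
    have hz' : ∀ e, α e * z e.castSucc + β e * z e.succ = 0 := fun e => congrFun hz e
    choose g hg₁ hg₂ using fun e => hαβ e _ _ (hz' e)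
    obtain ⟨τ, hτ, -⟩ := exists_curve_lift s ι (fun v => tangent (j v) ((E v).symm (z v))) g hg₁ hg₂
    have hτq : dualPoint K ≫ τ = q := curve_hom_ext s ι fun v => by
      rw [Category.assoc, hτ, dualPoint_tangent, ha]
    obtain ⟨θ, hθ⟩ := exists_lift_chart c τ fun x => by
      obtain ⟨y, rfl⟩ := dualPoint_surjective x
      rw [← Scheme.Hom.comp_apply, hτq, hq]
      exact hPc
    have hγθ : ∀ v, γ v ≫ θ = CommRingCat.ofHom (dualHom ((E v).symm (z v))) := fun v =>
      eq_of_map_comp_eq (j v) (by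
        rw [Spec.map_comp, Category.assoc, hγ, ← Category.assoc, hθ, hτ, tangent])
    have hθρ : θ ≫ CommRingCat.ofHom (TrivSqZeroExt.fstHom K K K).toRingHom = ρ :=
      eq_of_map_comp_eq c (by
        rw [Spec.map_comp, Category.assoc, hθ, hρ]; exact hτq)
    have hmem : (fun b => (θ.hom b).snd) ∈ pointDer φR.hom ρ.hom := by
      refine snd_mem_pointDer congr(($hθρ).hom) ?_
      have h1 : θ.hom.comp (γ 0).hom = dualHom ((E 0).symm (z 0)) := congr(($(hγθ 0)).hom)
      rw [hφγ 0, CommRingCat.hom_comp, ← RingHom.comp_assoc, h1, dualHom_comp]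
      rfl
    refine ⟨⟨_, hmem⟩, funext fun v => ?_⟩
    change E v (pointDerRestrict (γ v).hom ρ.hom _ ⟨_, hmem⟩) = z v
    rw [← (E v).eq_symm_apply]
    ext x
    have h1 : θ.hom.comp (γ v).hom = dualHom ((E v).symm (z v)) := congr(($(hγθ v)).hom)
    exact (congrArg TrivSqZeroExt.snd congr($h1 x)).trans (snd_dualHom _ _)
  obtain ⟨n, hn⟩ := exists_isStandardSmoothOfRelativeDimension hφR
  have hn1 : n ≤ 1 := by
    have : Nontrivial R := ρ.hom.domain_nontrivial
    have hqf : LocallyQuasiFinite (Spec.map (γ 0)) := by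
      have := locallyQuasiFinite_coord_zero s ι m
      have : LocallyQuasiFinite (Spec.map (γ 0) ≫ j 0) := by rw [hγ]; infer_instance
      exact LocallyQuasiFinite.of_comp _ (j 0)
    rw [HasRingHomProperty.Spec_iff (P := @LocallyQuasiFinite)] at hqf
    refine relativeDimension_le_one (hφ 0) hqf ?_
    rw [← CommRingCat.hom_comp, ← hφγ]
    exact hn
  obtain ⟨e⟩ := nonempty_pointDer_equiv hn ρ.hom
  have : Module.Finite K (pointDer φR.hom ρ.hom) := Module.Finite.equiv e.symm
  have h1 := two_le_finrank_ker_bidiagonal α β hij (hα i₀ hi) (hβ j₀ hj)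
  have h2 := Submodule.finrank_mono hker
  have h3 := (LinearMap.finrank_range_le L).trans e.finrank_eq.le
  simp only [Module.finrank_fintype_fun_eq_card, Fintype.card_fin] at h3
  -- The kernel has dimension at least 2, yet it lies in the image of a tangent space of dimension
  -- `n ≤ 1`.
  omega

/-- The singular points of the curves of a recursive tower given by a correspondence that is flat
and quasi-finite. -/
theorem isSingularPoint_iff [Mono ι] [SmoothOfRelativeDimension 1 s]
    [Flat (proj₁ s ι)] [LocallyOfFinitePresentation (proj₁ s ι)]
    [Flat (proj₂ s ι)] [LocallyOfFinitePresentation (proj₂ s ι)]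
    [LocallyQuasiFinite (proj₁ s ι)] (m : ℕ) (P : curve s ι m) :
    IsSingularPoint (curveStruct s ι m) P ↔ ∃ i j : Fin m, i ≤ j ∧
      ¬ IsEtaleAt (proj₂ s ι) (pairPoint s ι i P) ∧
      ¬ IsEtaleAt (proj₁ s ι) (pairPoint s ι j P) := by
  constructor
  · intro h
    by_contra! hc
    have : Smooth s := SmoothOfRelativeDimension.smooth 1 s
    exact not_isSingularPoint_of_forall s ι P (fun i j hij => by
      by_contra! h'
      exact h'.2 (hc i j hij h'.1)) h
  · rintro ⟨i, j, hij, hi, hj⟩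
    exact isSingularPoint_of_not_isEtaleAt s ι P hij hi hj

end Converse

/-! ### Flatness of dominant morphisms to smooth curves -/

section Flatness

/-- A morphism is flat if its composite with an étale morphism is flat. -/
lemma flat_of_comp_of_etale {X Y Z : Scheme.{u}} (f : X ⟶ Y) (g : Y ⟶ Z)
    [hfg : Flat (f ≫ g)] [hg : Etale g] : Flat f := by
  -- The diagonal of an étale morphism is an open immersion, hence flat.
  have : MorphismProperty.HasOfPostcompProperty (C := Scheme.{u}) @Flat @Etale :=
    MorphismProperty.hasOfPostcompProperty_iff_le_diagonal.mpr fun X Y f _ =>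
      inferInstanceAs <| Flat (pullback.diagonal f)
  exact MorphismProperty.of_postcomp (C := Scheme.{u}) @Flat (W' := @Etale) f g hg hfg

/-- Over a Bézout domain, flat means torsion-free. -/
lemma flat_of_injective_of_isBezout {R S : Type*} [CommRing R] [IsDomain R] [IsBezout R]
    [CommRing S] [IsDomain S] {f : R →+* S} (hf : Function.Injective f) : f.Flat := by
  algebraize [f]
  have : FaithfulSMul R S := (faithfulSMul_iff_algebraMap_injective R S).mpr hf
  change Module.Flat R S
  rw [Module.Flat.flat_iff_torsion_eq_bot_of_isBezout,
    ← Submodule.isTorsionFree_iff_torsion_eq_bot]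
  infer_instance

variable {k : Type u} [Field k] {X Y : Scheme.{u}}

/-- Dominant morphisms from integral schemes to smooth curves are flat. -/
lemma flat_of_denseRange (s : X ⟶ Spec (.of k)) [SmoothOfRelativeDimension 1 s] [IsIntegral Y]
    (h : Y ⟶ X) (hd : DenseRange h) : Flat h := by
  suffices H : ∀ y : Y, ∃ U : Y.Opens, y ∈ U ∧ Flat (U.ι ≫ h) by
    choose U hU hU' using H
    have : IsZariskiLocalAtSource @Flat.{u} := HasRingHomProperty.instIsZariskiLocalAtSource
    exact IsZariskiLocalAtSource.of_iSup_eq_top (P := @Flat) U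
      (top_le_iff.mp fun y _ => TopologicalSpace.Opens.mem_iSup.mpr ⟨y, hU y⟩) hU'
  intro y
  obtain ⟨A, j, φ, hj, hyj, -, -, hφ⟩ := exists_chart (P := @SmoothOfRelativeDimension 1) s ⊤
    (smoothOfRelativeDimension_one_comp_of_etale _ s) (h y) trivial
  obtain ⟨B, c, hc, ⟨x₀, hx₀⟩, hcj⟩ := exists_affine_chart (h ⁻¹ᵁ j.opensRange) y hyj
  obtain ⟨ψ, hψ⟩ := exists_lift_chart j (c ≫ h) fun x => by simpa using hcj x
  obtain ⟨g, -, hg⟩ := exists_etale_polynomial hφ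
  have : Nonempty (Spec B) := ⟨x₀⟩
  have : IsIntegral (Spec B) := isIntegral_of_isOpenImmersion c
  have hB : IsDomain B := by rwa [← affine_isIntegral_iff]
  have : Nontrivial A := ψ.hom.domain_nontrivial
  have hgf := (RingHom.Etale.iff_flat_and_formallyUnramified.mp hg).1
  -- The image of a nonzero `r` in `A` is a nonzerodivisor, hence not nilpotent, so its nonvanishing
  -- locus is a nonempty open set of `X`. It meets the dense range of `h`, and by irreducibility of
  -- `Y` its preimage meets the chart.
  have hinj : Function.Injective (ψ.hom.comp g) := by
    rw [injective_iff_map_eq_zero]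
    intro r hr
    by_contra h0
    have hreg := isRegular_map_of_flat hgf h0
    obtain ⟨p, hp⟩ : ∃ p : Spec A, g r ∉ p.asIdeal := by
      by_contra! hp
      have : IsNilpotent (g r) := by
        rw [nilpotent_iff_mem_prime]
        exact fun J hJ => hp ⟨J, hJ⟩
      obtain ⟨n, hn⟩ := this
      exact zero_notMem_nonZeroDivisors (hn ▸ pow_mem hreg n)
    let V : X.Opens := j ''ᵁ (PrimeSpectrum.basicOpen (g r))
    obtain ⟨z, hz⟩ := hd.exists_mem_open V.isOpen ⟨j p, p, hp, rfl⟩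
    obtain ⟨_, ⟨x, rfl⟩, x', hx', hxx'⟩ := nonempty_preirreducible_inter
      c.isOpenEmbedding.isOpen_range (V.isOpen.preimage h.continuous) ⟨_, x₀, rfl⟩ ⟨z, hz⟩
    have hx : Spec.map ψ x = x' := j.isOpenEmbedding.injective (Eq.trans (by
      rw [← Scheme.Hom.comp_apply, hψ, Scheme.Hom.comp_apply]) hxx'.symm)
    refine hx' ?_
    rw [← hx]
    change ψ.hom (g r) ∈ x.asIdeal
    exact (congrArg (· ∈ x.asIdeal) hr).mpr x.asIdeal.zero_mem
  let G : CommRingCat.of (Polynomial k) ⟶ A := CommRingCat.ofHom g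
  have hGe : Etale (Spec.map G) := by
    rwa [HasRingHomProperty.Spec_iff (P := @Etale)]
  have : Flat (Spec.map ψ ≫ Spec.map G) := by
    rw [← Spec.map_comp, Flat.SpecMap_iff]
    exact flat_of_injective_of_isBezout hinj
  have : Flat (Spec.map ψ) := flat_of_comp_of_etale _ (Spec.map G)
  rw [← hx₀]
  exact exists_opens_of_openImmersion (P := @Flat) c h (hψ ▸ inferInstance) x₀

end Flatness

/-- The singular points of the curves of the recursive tower of an irreducible correspondence. -/
theorem isSingularPoint_iff_of_isFinite {k : Type u} [Field k] {X : Scheme.{u}}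
    (s : X ⟶ Spec (.of k)) [SmoothOfRelativeDimension 1 s] {Γ : Scheme.{u}}
    (ι : Γ ⟶ pullback s s) [Mono ι] [IsReduced Γ] [GeometricallyIrreducible (proj₁ s ι ≫ s)]
    [IsFinite (proj₁ s ι)] [Surjective (proj₁ s ι)]
    [IsFinite (proj₂ s ι)] [Surjective (proj₂ s ι)] (m : ℕ) (P : curve s ι m) :
    IsSingularPoint (curveStruct s ι m) P ↔ ∃ i j : Fin m, i ≤ j ∧
      ¬ IsEtaleAt (proj₂ s ι) (pairPoint s ι i P) ∧
      ¬ IsEtaleAt (proj₁ s ι) (pairPoint s ι j P) := by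
  have : IrreducibleSpace Γ :=
    GeometricallyIrreducible.irreducibleSpace_of_subsingleton (f := proj₁ s ι ≫ s)
  have : IsIntegral Γ := isIntegral_of_irreducibleSpace_of_isReduced Γ
  have : Smooth s := SmoothOfRelativeDimension.smooth 1 s
  have : IsLocallyNoetherian X := LocallyOfFiniteType.isLocallyNoetherian s
  have := flat_of_denseRange s _ (proj₁ s ι).surjective.denseRange
  have := flat_of_denseRange s _ (proj₂ s ι).surjective.denseRange
  exact isSingularPoint_iff s ι m P

/-! ### Nonconstant endomorphisms of an integral smooth curve -/

section Curve

variable {k : Type u} [Field k] {X : Scheme.{u}} (s : X ⟶ Spec (.of k))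
  [SmoothOfRelativeDimension 1 s] [IsIntegral X]

-- In a chart, nonzero primes are maximal (`isMaximal_of_etale_polynomial`), so a point that is not
-- generic has no proper specialization.
include s in
lemma isClosed_singleton_of_ne_genericPoint {x : X} (hx : x ≠ genericPoint X) :
    IsClosed ({x} : Set X) := by
  rw [← closure_subset_iff_isClosed]
  intro y hy
  obtain ⟨A, j, φ, hj, ⟨q, rfl⟩, -, -, hφ⟩ := exists_chart (P := @SmoothOfRelativeDimension 1) s ⊤
    (smoothOfRelativeDimension_one_comp_of_etale _ s) y trivial
  obtain ⟨_, ⟨p, rfl⟩, hp⟩ := mem_closure_iff.mp hy _ j.isOpenEmbedding.isOpen_range ⟨q, rfl⟩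
  obtain rfl : j p = x := hp
  have : Nonempty (Spec A) := ⟨p⟩
  have : IsIntegral (Spec A) := isIntegral_of_isOpenImmersion j
  have hA : IsDomain A := by rwa [← affine_isIntegral_iff]
  obtain ⟨g, -, hg⟩ := exists_etale_polynomial hφ
  have hpq : p ⤳ q := j.isOpenEmbedding.isInducing.specializes_iff.mp
    (specializes_iff_mem_closure.mpr hy)
  have hle : p.asIdeal ≤ q.asIdeal := (PrimeSpectrum.le_iff_specializes p q).mpr hpq
  have hp0 : p.asIdeal ≠ ⊥ := by
    intro h
    refine hx ?_
    rw [← genericPoint_eq_of_isOpenImmersion j, genericPoint_eq_bot_of_affine]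
    exact congrArg j (PrimeSpectrum.ext h)
  have := p.isPrime
  have := isMaximal_of_etale_polynomial hg p.asIdeal hp0
  exact congrArg j (PrimeSpectrum.ext (this.eq_of_le q.2.ne_top hle).symm)

variable {f : X ⟶ X} (hf : ∃ x y, f x ≠ f y)

-- If the generic point went to a closed point, the fibre over that point would be closed and
-- contain the generic point, so `f` would be constant.
include s hf in
lemma map_genericPoint : f (genericPoint X) = genericPoint X := by
  by_contra h
  have hc := (isClosed_singleton_of_ne_genericPoint s h).preimage f.continuous
  have (x : X) : f x = f (genericPoint X) :=
    (genericPoint_specializes x).mem_closed hc rfl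
  obtain ⟨x, y, hxy⟩ := hf
  exact hxy ((this x).trans (this y).symm)

include s hf in
lemma denseRange_of_nonconstant : DenseRange f := by
  have h : {genericPoint X} ⊆ Set.range f :=
    Set.singleton_subset_iff.mpr ⟨_, map_genericPoint s hf⟩
  exact fun x => closure_mono h (genericPoint_closure (α := X) ▸ Set.mem_univ x)

include s in
lemma finite_of_isClosed [CompactSpace X] {Z : Set X} (hZ : IsClosed Z)
    (h : genericPoint X ∉ Z) : Z.Finite := by
  have : Smooth s := SmoothOfRelativeDimension.smooth 1 s
  have : IsLocallyNoetherian X := LocallyOfFiniteType.isLocallyNoetherian s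
  have : IsNoetherian X := {}
  obtain ⟨S, hS, hSc, hSi, rfl⟩ :=
    TopologicalSpace.NoetherianSpace.exists_finite_set_isClosed_irreducible hZ
  refine hS.sUnion fun t ht => ?_
  obtain ⟨x, hx⟩ := QuasiSober.sober (hSi t ht) (hSc t ht)
  have hx' : x ≠ genericPoint X := by
    rintro rfl
    exact h ⟨t, ht, hx.mem⟩
  rw [← hx.def, (isClosed_singleton_of_ne_genericPoint s hx').closure_eq]
  exact Set.finite_singleton x

-- The fibre over a closed point is a closed set missing the generic point, hence finite. Closed
-- points map to closed points, so only the generic point lies over the generic point.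
include s hf in
lemma locallyQuasiFinite_of_nonconstant [CompactSpace X] [LocallyOfFiniteType f] :
    LocallyQuasiFinite f := by
  refine .of_finite_preimage_singleton f fun y => ?_
  by_cases hy : y = genericPoint X
  · refine (Set.finite_singleton (genericPoint X)).subset fun x hx => ?_
    by_contra hx'
    have : Smooth s := SmoothOfRelativeDimension.smooth 1 s
    have : JacobsonSpace X := LocallyOfFiniteType.jacobsonSpace s
    have h1 : IsClosed {f x} := f.closePoints_subset_preimage_closedPoints
      (isClosed_singleton_of_ne_genericPoint s hx')
    obtain rfl : f x = y := hx
    rw [hy, ← closure_eq_iff_isClosed, genericPoint_closure] at h1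
    exact hx' (h1 ▸ Set.mem_univ x)
  · refine finite_of_isClosed s
      ((isClosed_singleton_of_ne_genericPoint s hy).preimage f.continuous) fun h => hy ?_
    rw [← map_genericPoint s hf]
    exact h.symm

end Curve

/-! ### Smoothness of the affine line -/

section Polynomial

lemma isStandardSmoothOfRelativeDimension_polynomial_C (k : Type u) [CommRing k] :
    (Polynomial.C : k →+* Polynomial k).IsStandardSmoothOfRelativeDimension 1 := by
  rw [← Polynomial.algebraMap_eq, RingHom.isStandardSmoothOfRelativeDimension_algebraMap]
  let P : Algebra.SubmersivePresentation k (MvPolynomial (Fin 1) k) (Fin 1) PEmpty.{1} :=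
    { Algebra.Generators.mvPolynomial k (Fin 1) with
      relation := PEmpty.elim
      span_range_relation_eq_ker := by
        rw [Set.range_eq_empty, Ideal.span_empty]
        exact (Algebra.Generators.ker_mvPolynomial ..).symm
      map := PEmpty.elim
      map_inj := fun a => a.elim
      jacobian_isUnit := by
        rw [Algebra.PreSubmersivePresentation.jacobian_eq_jacobiMatrix_det, Matrix.det_isEmpty,
          map_one]
        exact isUnit_one }
  have := P.isStandardSmoothOfRelativeDimension (n := 1) (by
    simp [Algebra.Presentation.dimension])
  exact .of_algEquiv 1 (MvPolynomial.uniqueAlgEquiv k (Fin 1))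

end Polynomial

/-! ### The projective line is an integral smooth curve -/

section ProjectiveLine

attribute [local instance] MvPolynomial.gradedAlgebra
open HomogeneousLocalization MvPolynomial

lemma map_eq_pow_mul_of_isHomogeneous {σ R L : Type*} [CommRing R] [CommRing L]
    {φ ψ : MvPolynomial σ R →+* L} {t : L} (hC : ∀ c, φ (C c) = ψ (C c))
    (hX : ∀ j, φ (X j) = t * ψ (X j)) {x : MvPolynomial σ R} {n : ℕ} (hx : x.IsHomogeneous n) :
    φ x = t ^ n * ψ x := by
  conv_lhs => rw [← support_sum_monomial_coeff x]
  conv_rhs => rw [← support_sum_monomial_coeff x]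
  rw [map_sum, map_sum, Finset.mul_sum]
  refine Finset.sum_congr rfl fun d hd => ?_
  have hd' : d.degree = n := by
    rw [Finsupp.degree_eq_weight_one]
    exact hx (mem_support_iff.mp hd)
  rw [monomial_eq, map_mul, map_mul, hC, ← hd', Finsupp.degree_apply, Finsupp.prod, map_prod, map_prod,
    ← Finset.prod_pow_eq_pow_sum, mul_left_comm, ← Finset.prod_mul_distrib]
  simp [hX, mul_pow]

variable (k : Type u) [Field k] (i : Fin 2)

lemma X_mem_homogeneousSubmodule : (X i : MvPolynomial (Fin 2) k) ∈
    homogeneousSubmodule (Fin 2) k 1 :=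
  isHomogeneous_X k i

/-- The coordinate `T_{1-i} / T_i` on the standard chart `T_i ≠ 0` of the projective line, as a
ring homomorphism. -/
noncomputable def awayHom : Polynomial k →+* Away (homogeneousSubmodule (Fin 2) k) (X i) :=
  Polynomial.eval₂RingHom ((fromZeroRingHom (homogeneousSubmodule (Fin 2) k) _).comp
    (algebraMap k (homogeneousSubmodule (Fin 2) k 0)))
    -- In `Fin 2`, `i + 1` is the index other than `i`.
    (Away.mk _ (X_mem_homogeneousSubmodule k i) 1 (X (i + 1)) (X_mem_homogeneousSubmodule k (i + 1)))

lemma awayHom_comp_C : (awayHom k i).comp Polynomial.C =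
    (fromZeroRingHom (homogeneousSubmodule (Fin 2) k) _).comp
      (algebraMap k (homogeneousSubmodule (Fin 2) k 0)) :=
  Polynomial.eval₂RingHom_comp_C _ _

/-- Dehomogenization of polynomials in two variables. -/
noncomputable def dehomogenize : MvPolynomial (Fin 2) k →+* Polynomial k :=
  (aeval fun j => if j = i then 1 else Polynomial.X).toRingHom

lemma val_awayHom_C (c : k) : (awayHom k i (Polynomial.C c)).val =
    algebraMap (MvPolynomial (Fin 2) k) (Localization.Away (X i : MvPolynomial (Fin 2) k)) (C c) := by
  rw [← RingHom.comp_apply, awayHom_comp_C]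
  rfl

lemma mul_val_awayHom_X :
    algebraMap (MvPolynomial (Fin 2) k) (Localization.Away (X i : MvPolynomial (Fin 2) k)) (X i) *
      (awayHom k i Polynomial.X).val = algebraMap (MvPolynomial (Fin 2) k) _ (X (i + 1)) := by
  rw [awayHom, Polynomial.coe_eval₂RingHom, Polynomial.eval₂_X, Away.val_mk,
    Localization.mk_eq_mk', mul_comm]
  have := IsLocalization.mk'_spec (Localization.Away (X i : MvPolynomial (Fin 2) k)) (X (i + 1))
    (⟨X i ^ 1, ⟨1, rfl⟩⟩ : Submonoid.powers (X i : MvPolynomial (Fin 2) k))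
  convert this using 3
  exact (pow_one _).symm

lemma algebraMap_eq_dehomogenize {x : MvPolynomial (Fin 2) k} {n : ℕ} (hx : x.IsHomogeneous n) :
    algebraMap (MvPolynomial (Fin 2) k) (Localization.Away (X i : MvPolynomial (Fin 2) k)) x =
      algebraMap (MvPolynomial (Fin 2) k) _ (X i) ^ n * (awayHom k i (dehomogenize k i x)).val := by
  let ψ : MvPolynomial (Fin 2) k →+* Localization.Away (X i : MvPolynomial (Fin 2) k) :=
    ((algebraMap (Away (homogeneousSubmodule (Fin 2) k) (X i)) _).comp (awayHom k i)).comp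
      (dehomogenize k i)
  refine map_eq_pow_mul_of_isHomogeneous (ψ := ψ) (fun c => ?_) (fun j => ?_) hx
  · simp [ψ, dehomogenize, val_awayHom_C]
  · by_cases hj : j = i
    · simp [ψ, dehomogenize, hj]
    · obtain rfl : j = i + 1 := by revert i j; decide
      simp [ψ, dehomogenize, mul_val_awayHom_X]

/-- Dehomogenization extends to the localization and gives a left inverse. Conversely, a degree-zero
fraction $x/T_i^n$ is the image of the dehomogenization of $x$. -/
lemma awayHom_bijective : Function.Bijective (awayHom k i) := by
  constructor
  · have hu : IsUnit (dehomogenize k i (X i)) := by simp [dehomogenize]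
    let ρ : Away (homogeneousSubmodule (Fin 2) k) (X i) →+* Polynomial k :=
      (IsLocalization.Away.lift (S := Localization.Away (X i : MvPolynomial (Fin 2) k)) (X i)
        hu).comp (algebraMap _ _)
    have hρ (z) : ρ z = IsLocalization.Away.lift (X i) hu z.val := rfl
    have : ρ.comp (awayHom k i) = .id _ := by
      refine Polynomial.ringHom_ext (fun c => ?_) ?_
      · simp [hρ, val_awayHom_C, dehomogenize]
      · have := congrArg (IsLocalization.Away.lift (X i) hu) (mul_val_awayHom_X k i)
        rw [map_mul, IsLocalization.Away.lift_eq, IsLocalization.Away.lift_eq] at this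
        simpa [hρ, dehomogenize] using this
    exact Function.LeftInverse.injective (g := ρ) fun x => congr($this x)
  · intro z
    obtain ⟨n, x, hx, rfl⟩ := Away.mk_surjective _ (X_mem_homogeneousSubmodule k i) z
    refine ⟨dehomogenize k i x, ?_⟩
    have hx' : x.IsHomogeneous n := by simpa using hx
    refine val_injective _ ?_
    rw [Away.val_mk, Localization.mk_eq_mk', IsLocalization.eq_mk'_iff_mul_eq, mul_comm,
      algebraMap_eq_dehomogenize k i hx', map_pow]

/-- The standard charts of the projective line. -/
noncomputable def P1Chart : Spec (.of (Away (homogeneousSubmodule (Fin 2) k) (X i))) ⟶ P1 k :=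
  Proj.awayι _ (X i) (X_mem_homogeneousSubmodule k i) one_pos

instance : IsOpenImmersion (P1Chart k i) :=
  inferInstanceAs (IsOpenImmersion
    (Proj.awayι _ (X i) (X_mem_homogeneousSubmodule k i) one_pos))

lemma P1Chart_comp : P1Chart k i ≫ P1Struct k =
    Spec.map (CommRingCat.ofHom ((awayHom k i).comp Polynomial.C)) := by
  refine (Proj.awayι_toSpecZero_assoc _ _ (X_mem_homogeneousSubmodule k i) one_pos _).trans ?_
  rw [← Spec.map_comp, ← CommRingCat.ofHom_comp, awayHom_comp_C]

lemma exists_P1Chart (x : P1 k) : ∃ i, x ∈ Set.range (P1Chart k i) := by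
  have h := Proj.iSup_basicOpen_eq_top' (homogeneousSubmodule (Fin 2) k) X
    (fun i => ⟨1, X_mem_homogeneousSubmodule k i⟩) (by
      refine top_le_iff.mp fun p _ => ?_
      induction p using MvPolynomial.induction_on with
      | C c => exact Subalgebra.algebraMap_mem _ (algebraMap k (homogeneousSubmodule (Fin 2) k 0) c)
      | add p q hp hq => exact add_mem (hp trivial) (hq trivial)
      | mul_X p i hp => exact mul_mem (hp trivial) (Algebra.subset_adjoin ⟨i, rfl⟩))
  obtain ⟨i, hi⟩ := TopologicalSpace.Opens.mem_iSup.mp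
    (h.ge (TopologicalSpace.Opens.mem_top (x : Proj (homogeneousSubmodule (Fin 2) k))))
  refine ⟨i, ?_⟩
  rwa [← Proj.opensRange_awayι _ _ (X_mem_homogeneousSubmodule k i) one_pos] at hi

instance : SmoothOfRelativeDimension 1 (P1Struct k) := by
  have := smoothOfRelativeDimension_isStableUnderBaseChange.{u} 1
  have : IsZariskiLocalAtSource (@SmoothOfRelativeDimension.{u} 1) :=
    HasRingHomProperty.instIsZariskiLocalAtSource
  suffices H : ∀ x : P1 k, ∃ U : (P1 k).Opens, x ∈ U ∧
      SmoothOfRelativeDimension 1 (U.ι ≫ P1Struct k) by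
    choose U hU hU' using H
    exact IsZariskiLocalAtSource.of_iSup_eq_top U
      (top_le_iff.mp fun y _ => TopologicalSpace.Opens.mem_iSup.mpr ⟨y, hU y⟩) hU'
  intro x
  obtain ⟨i, y, rfl⟩ := exists_P1Chart k x
  refine exists_opens_of_openImmersion (P := @SmoothOfRelativeDimension 1) (P1Chart k i) _ ?_ y
  rw [P1Chart_comp, HasRingHomProperty.Spec_iff (P := @SmoothOfRelativeDimension 1)]
  refine RingHom.locally_of RingHom.isStandardSmoothOfRelativeDimension_respectsIso _ ?_
  exact RingHom.isStandardSmoothOfRelativeDimension_respectsIso.1 _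
    (RingEquiv.ofBijective _ (awayHom_bijective k i))
    (isStandardSmoothOfRelativeDimension_polynomial_C k)

instance : CompactSpace (P1 k) := by
  refine ⟨?_⟩
  have : Set.univ = ⋃ i, Set.range (P1Chart k i) :=
    (Set.eq_univ_of_forall fun x => Set.mem_iUnion.mpr (exists_P1Chart k x)).symm
  rw [this]
  exact isCompact_iUnion fun i => isCompact_range (P1Chart k i).continuous

/-- The generic point of the projective line. -/
noncomputable def P1GenericPoint : ProjectiveSpectrum (homogeneousSubmodule (Fin 2) k) where
  asHomogeneousIdeal := ⊥
  isPrime := by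
    rw [HomogeneousIdeal.toIdeal_bot]
    exact Ideal.isPrime_bot
  not_irrelevant_le h := by
    have : (X 0 : MvPolynomial (Fin 2) k) ∈ (⊥ : HomogeneousIdeal (homogeneousSubmodule (Fin 2) k)) :=
      h (HomogeneousIdeal.mem_irrelevant_of_mem _ one_pos (X_mem_homogeneousSubmodule k 0))
    exact X_ne_zero 0 (show (X 0 : MvPolynomial (Fin 2) k) = 0 from this)

instance : IrreducibleSpace (P1 k) := by
  rw [irreducibleSpace_def]
  have h : closure {(P1GenericPoint k : P1 k)} = Set.univ :=
    Set.eq_univ_of_forall fun y => (ProjectiveSpectrum.le_iff_mem_closure _ _ _).mp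
      (show P1GenericPoint k ≤ y from bot_le (a := y.asHomogeneousIdeal))
  exact (congrArg IsIrreducible h).mp isIrreducible_singleton.closure

instance : IsReduced (P1 k) := by
  suffices ∀ x : P1 k, _root_.IsReduced ((P1 k).presheaf.stalk x) from
    isReduced_of_isReduced_stalk _
  intro x
  obtain ⟨i, y, rfl⟩ := exists_P1Chart k x
  have : IsDomain (Away (homogeneousSubmodule (Fin 2) k) (X i)) :=
    (RingEquiv.ofBijective _ (awayHom_bijective k i)).symm.toMulEquiv.isDomain (Polynomial k)
  exact isReduced_of_injective ((P1Chart k i).stalkMap y).hom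
    (ConcreteCategory.bijective_of_isIso ((P1Chart k i).stalkMap y)).1

instance : IsIntegral (P1 k) := isIntegral_of_irreducibleSpace_of_isReduced _

end ProjectiveLine

/-! ### Ramification under base change -/

section RamifiedBaseChange

lemma isNilpotent_ker_dualPoint (K : Type u) [Field K] : IsNilpotent (dualPoint K).ker := by
  refine ⟨2, Scheme.IdealSheafData.ext_of_isAffine ?_⟩
  change (dualPoint K).ker.ideal ⟨⊤, _⟩ ^ 2 = (⊥ : Ideal _)
  rw [show (dualPoint K).ker.ideal ⟨⊤, isAffineOpen_top _⟩ = _ from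
    Scheme.Hom.ker_apply (dualPoint K) _]
  let e := Scheme.ΓSpecIso (.of (DualNumber K))
  have h (x) (hx : x ∈ RingHom.ker ((dualPoint K).app ⊤).hom) : (e.hom x).fst = 0 := by
    have := congr($(Scheme.ΓSpecIso_naturality
      (CommRingCat.ofHom (TrivSqZeroExt.fstHom K K K).toRingHom)) x)
    refine Eq.trans this.symm ?_
    exact (congrArg (Scheme.ΓSpecIso (.of K)).hom hx).trans (map_zero (Scheme.ΓSpecIso (.of K)).hom.hom)
  rw [sq, ← le_bot_iff, Ideal.mul_le]
  intro x hx y hy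
  refine (ConcreteCategory.bijective_of_isIso e.hom).1 ?_
  refine (map_mul e.hom.hom x y).trans (Eq.trans ?_ (map_zero e.hom.hom).symm)
  have hx' := h x hx
  have hy' := h y hy
  change (e.hom x * e.hom y : DualNumber K) = 0
  generalize (e.hom x : DualNumber K) = X at *
  generalize (e.hom y : DualNumber K) = Y at *
  ext <;> simp [hx', hy']

instance (K : Type u) [Field K] : IsClosedImmersion (dualPoint K) :=
  IsClosedImmersion.spec_of_surjective _ TrivSqZeroExt.fst_surjective

/-- Ramification is invariant under base change, at points. -/
lemma IsRamifiedAt.of_isPullback {Y' Y Z' Z : Scheme.{u}} {f' : Y' ⟶ Z'} {g' : Y' ⟶ Y} {g : Z' ⟶ Z}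
    {f : Y ⟶ Z} [LocallyOfFiniteType f] (h : IsPullback f' g' g f) {y : Y'}
    (hf : IsRamifiedAt f (g' y)) : IsRamifiedAt f' y := by
  rintro ⟨U, hyU, hU⟩
  obtain ⟨K, _, q, hq⟩ : ∃ (K : Type u) (_ : Field K) (q : Spec (.of K) ⟶ Y'), ∀ x, q x = y :=
    ⟨Y'.residueField y, inferInstance, Y'.fromSpecResidueField y,
      fun x => Scheme.fromSpecResidueField_apply y x⟩
  let x₀ : Spec (.of K) := ⟨⊥, Ideal.isPrime_bot⟩
  obtain ⟨A, j, hj, hyj, -⟩ := exists_affine_chart ⊤ (f (g' y)) trivial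
  obtain ⟨B, c, hc, hyc, hcj⟩ := exists_affine_chart (f ⁻¹ᵁ j.opensRange) (g' y) hyj
  obtain ⟨α, hα⟩ := exists_lift_chart j (c ≫ f) fun x => by simpa using hcj x
  obtain ⟨b, hb⟩ := exists_lift_chart c (q ≫ g') fun x => by
    rw [Scheme.Hom.comp_apply, hq]; exact hyc
  have hbx : c (Spec.map b x₀) = g' y := by
    rw [← Scheme.Hom.comp_apply, hb, Scheme.Hom.comp_apply, hq]
  obtain ⟨d, hd, hd0⟩ := exists_pointDer_of_isRamifiedAt f c j α hα b x₀ (hbx ▸ hf)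
  let r : Spec (.of (DualNumber K)) ⟶ Spec (.of K) :=
    Spec.map (CommRingCat.ofHom (TrivSqZeroExt.inlHom K K))
  have hr : dualPoint K ≫ r = 𝟙 _ := by
    rw [dualPoint, ← Spec.map_comp, ← CommRingCat.ofHom_comp, ← Spec.map_id]
    rfl
  let t (d : pointDer α.hom b.hom) : Spec (.of (DualNumber K)) ⟶ Y := tangent c d
  have ht (d) : t d ≫ f = r ≫ q ≫ g' ≫ f := by
    have h1 : α ≫ CommRingCat.ofHom (dualHom d) = (α ≫ b) ≫
        CommRingCat.ofHom (TrivSqZeroExt.inlHom K K) := CommRingCat.hom_ext (dualHom_comp d)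
    rw [← Category.assoc q, ← hb, Category.assoc, ← hα, ← Category.assoc (Spec.map b),
      ← Spec.map_comp, ← Category.assoc, ← Spec.map_comp, ← h1]
    simp only [t, tangent, Category.assoc, ← hα, Spec.map_comp]
  have ht' (d) : dualPoint K ≫ t d = q ≫ g' := (dualPoint_tangent c d).trans hb
  -- A tangent vector of `Y` relative to `Z` pairs with the constant tangent vector of `Z'` to give
  -- one of `Y'` relative to `Z'`.
  let T (d : pointDer α.hom b.hom) : Spec (.of (DualNumber K)) ⟶ Y' :=
    h.lift (r ≫ q ≫ f') (t d) (by
      rw [Category.assoc, Category.assoc, h.w, ht])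
  have hT₁ (d) : T d ≫ f' = r ≫ q ≫ f' := h.lift_fst _ _ _
  have hT₂ (d) : T d ≫ g' = t d := h.lift_snd _ _ _
  have hTq (d) : dualPoint K ≫ T d = q := h.hom_ext
    (by rw [Category.assoc, hT₁, ← Category.assoc, hr, Category.id_comp])
    (by rw [Category.assoc, hT₂, ht'])
  have hTU (d) : Set.range (T d) ⊆ Set.range U.ι := by
    rintro _ ⟨x, rfl⟩
    obtain ⟨x, rfl⟩ := dualPoint_surjective x
    rw [← Scheme.Hom.comp_apply, hTq, hq, Scheme.Opens.range_ι]
    exact hyU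
  -- The vectors attached to `d` and `0` agree at the closed point and after `f'`, so infinitesimal
  -- uniqueness for unramified morphisms identifies them and forces `d = 0`.
  have hTU' : IsOpenImmersion.lift U.ι (T ⟨d, hd⟩) (hTU _) =
      IsOpenImmersion.lift U.ι (T 0) (hTU _) := by
    refine FormallyUnramified.hom_ext (dualPoint K) (isNilpotent_ker_dualPoint K) (U.ι ≫ f') ?_ ?_
    · rw [← cancel_mono U.ι]
      simp only [Category.assoc, IsOpenImmersion.lift_fac, hTq]
    · rw [← Category.assoc, ← Category.assoc, IsOpenImmersion.lift_fac, IsOpenImmersion.lift_fac,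
        hT₁, hT₁]
  have hTT : T ⟨d, hd⟩ = T 0 := by
    rw [← IsOpenImmersion.lift_fac U.ι (T ⟨d, hd⟩) (hTU _), hTU', IsOpenImmersion.lift_fac]
  have htt : t ⟨d, hd⟩ = t 0 := by rw [← hT₂, hTT, hT₂]
  have := eq_of_map_comp_eq c htt
  refine hd0 (funext fun x => ?_)
  simpa using congr(TrivSqZeroExt.snd (($this).hom x))

end RamifiedBaseChange

/-! ### Correspondences with separated variables -/

section Separated

lemma separatedEmb_proj₁ {X S : Scheme.{u}} (s : X ⟶ S) (f g : X ⟶ X) (hf : f ≫ s = s)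
    (hg : g ≫ s = s) : proj₁ s (separatedEmb s f g hf hg) = pullback.fst f g :=
  pullback.lift_fst _ _ _

lemma separatedEmb_proj₂ {X S : Scheme.{u}} (s : X ⟶ S) (f g : X ⟶ X) (hf : f ≫ s = s)
    (hg : g ≫ s = s) : proj₂ s (separatedEmb s f g hf hg) = pullback.snd f g :=
  pullback.lift_snd _ _ _

instance {X S : Scheme.{u}} (s : X ⟶ S) (f g : X ⟶ X) (hf : f ≫ s = s) (hg : g ≫ s = s) :
    Mono (separatedEmb s f g hf hg) where
  right_cancellation a b h := by
    apply pullback.hom_ext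
    · rw [← separatedEmb_proj₁ s f g hf hg, proj₁, ← Category.assoc, h, Category.assoc]
    · rw [← separatedEmb_proj₂ s f g hf hg, proj₂, ← Category.assoc, h, Category.assoc]

lemma isEtaleAt_iff_not_isRamifiedAt_of_isPullback {Y' Y Z' Z : Scheme.{u}} {f' : Y' ⟶ Z'}
    {g' : Y' ⟶ Y} {g : Z' ⟶ Z} {f : Y ⟶ Z} [Flat f] [LocallyOfFinitePresentation f]
    (h : IsPullback f' g' g f) (y : Y') : IsEtaleAt f' y ↔ ¬ IsRamifiedAt f (g' y) := by
  constructor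
  · rintro ⟨U, hy, hU⟩ hr
    exact IsRamifiedAt.of_isPullback h hr ⟨U, hy, inferInstance⟩
  · intro hr
    exact IsEtaleAt.of_isPullback h ((isEtaleAt_iff_not_isRamifiedAt f _).mpr hr)

/-- Edge `i` runs from vertex `i` to vertex `i + 1`, so `i ≤ j` for edges becomes `i < j + 1` for
the vertices concerned. -/
lemma exists_castSucc_succ_iff {m : ℕ} {p q : Fin (m + 1) → Prop} :
    (∃ i j : Fin m, i ≤ j ∧ p i.castSucc ∧ q j.succ) ↔
      ∃ i j : Fin (m + 1), i < j ∧ p i ∧ q j := by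
  constructor
  · rintro ⟨i, j, hij, hp, hq⟩
    exact ⟨_, _, Fin.castSucc_lt_succ_iff.mpr hij, hp, hq⟩
  · rintro ⟨i, j, hij, hp, hq⟩
    obtain ⟨i, rfl⟩ := Fin.exists_castSucc_eq.mpr (ne_of_lt (hij.trans_le (Fin.le_last j)))
    obtain ⟨j, rfl⟩ := Fin.exists_succ_eq.mpr (ne_of_gt ((Fin.zero_le _).trans_lt hij))
    exact ⟨i, j, Fin.castSucc_lt_succ_iff.mp hij, hp, hq⟩

/-- The singular points of the curves of the recursive tower of a correspondence with separated
variables. -/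
theorem isSingularPoint_iff_of_separated {k : Type u} [Field k] {X : Scheme.{u}}
    (s : X ⟶ Spec (.of k)) [SmoothOfRelativeDimension 1 s] [IsIntegral X] [CompactSpace X]
    (f g : X ⟶ X) (hf : f ≫ s = s) (hg : g ≫ s = s) (hf' : ∃ x y, f x ≠ f y)
    (hg' : ∃ x y, g x ≠ g y) (m : ℕ) (P : curve s (separatedEmb s f g hf hg) m) :
    IsSingularPoint (curveStruct s (separatedEmb s f g hf hg) m) P ↔
      ∃ i j : Fin (m + 1), i < j ∧
        IsRamifiedAt f (coord s (separatedEmb s f g hf hg) i P) ∧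
        IsRamifiedAt g (coord s (separatedEmb s f g hf hg) j P) := by
  have : Smooth s := SmoothOfRelativeDimension.smooth 1 s
  have : IsLocallyNoetherian X := LocallyOfFiniteType.isLocallyNoetherian s
  have : LocallyOfFiniteType f := by
    have : LocallyOfFiniteType (f ≫ s) := hf.symm ▸ inferInstance
    exact locallyOfFiniteType_of_comp f s
  have : LocallyOfFiniteType g := by
    have : LocallyOfFiniteType (g ≫ s) := hg.symm ▸ inferInstance
    exact locallyOfFiniteType_of_comp g s
  have := flat_of_denseRange s f (denseRange_of_nonconstant s hf')
  have := flat_of_denseRange s g (denseRange_of_nonconstant s hg')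
  have := locallyQuasiFinite_of_nonconstant s hg'
  have h₁ := separatedEmb_proj₁ s f g hf hg
  have h₂ := separatedEmb_proj₂ s f g hf hg
  have : Flat (proj₁ s (separatedEmb s f g hf hg)) := h₁ ▸ inferInstance
  have : Flat (proj₂ s (separatedEmb s f g hf hg)) := h₂ ▸ inferInstance
  have : LocallyOfFinitePresentation (proj₁ s (separatedEmb s f g hf hg)) := h₁ ▸ inferInstance
  have : LocallyOfFinitePresentation (proj₂ s (separatedEmb s f g hf hg)) := h₂ ▸ inferInstance
  have : LocallyQuasiFinite (proj₁ s (separatedEmb s f g hf hg)) := h₁ ▸ inferInstance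
  -- The first projection is the base change of `g` along `f`, so its ramification at an edge is
  -- that of `g` at the end vertex; symmetrically, the second projection sees `f` at the start
  -- vertex.
  have e₁ (j : Fin m) : ¬ IsEtaleAt (proj₁ s (separatedEmb s f g hf hg))
      (pairPoint s (separatedEmb s f g hf hg) j P) ↔
        IsRamifiedAt g (coord s (separatedEmb s f g hf hg) j.succ P) := by
    rw [← pairPoint_proj₂, Scheme.Hom.comp_apply, h₁, h₂,
      isEtaleAt_iff_not_isRamifiedAt_of_isPullback (IsPullback.of_hasPullback f g), not_not]
  have e₂ (i : Fin m) : ¬ IsEtaleAt (proj₂ s (separatedEmb s f g hf hg))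
      (pairPoint s (separatedEmb s f g hf hg) i P) ↔
        IsRamifiedAt f (coord s (separatedEmb s f g hf hg) i.castSucc P) := by
    rw [← pairPoint_proj₁, Scheme.Hom.comp_apply, h₁, h₂,
      isEtaleAt_iff_not_isRamifiedAt_of_isPullback (IsPullback.of_hasPullback f g).flip, not_not]
  rw [isSingularPoint_iff]
  simp only [e₁, e₂]
  exact exists_castSucc_succ_iff
    (p := fun i => IsRamifiedAt f (coord s (separatedEmb s f g hf hg) i P))
    (q := fun j => IsRamifiedAt g (coord s (separatedEmb s f g hf hg) j P))

end Separated

end RecursiveTower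

theorem mainTheorem8 (k : Type u) [Field k] :
    (∀ (X : Scheme.{u}) (s : X ⟶ Spec (CommRingCat.of k))
      [IsProper s] [SmoothOfRelativeDimension 1 s] [GeometricallyIrreducible s]
      (Γ : Scheme.{u}) (ι : Γ ⟶ pullback s s)
      [IsClosedImmersion ι] [IsReduced Γ]
      [GeometricallyIrreducible (RecursiveTower.proj₁ s ι ≫ s)]
      [IsFinite (RecursiveTower.proj₁ s ι)] [Surjective (RecursiveTower.proj₁ s ι)]
      [IsFinite (RecursiveTower.proj₂ s ι)] [Surjective (RecursiveTower.proj₂ s ι)]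
      (m : ℕ) (P : RecursiveTower.curve s ι m),
      RecursiveTower.IsSingularPoint (RecursiveTower.curveStruct s ι m) P ↔
        ∃ i j : Fin m, i ≤ j ∧
          ¬ RecursiveTower.IsEtaleAt (RecursiveTower.proj₂ s ι)
              (RecursiveTower.pairPoint s ι i P) ∧
          ¬ RecursiveTower.IsEtaleAt (RecursiveTower.proj₁ s ι)
              (RecursiveTower.pairPoint s ι j P)) ∧
    (∀ (f g : RecursiveTower.P1 k ⟶ RecursiveTower.P1 k)
      (hf : f ≫ RecursiveTower.P1Struct k = RecursiveTower.P1Struct k)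
      (hg : g ≫ RecursiveTower.P1Struct k = RecursiveTower.P1Struct k)
      (_ : ∃ x y : RecursiveTower.P1 k, f x ≠ f y)
      (_ : ∃ x y : RecursiveTower.P1 k, g x ≠ g y)
      (m : ℕ)
      (P : RecursiveTower.curve (RecursiveTower.P1Struct k)
        (RecursiveTower.separatedEmb (RecursiveTower.P1Struct k) f g hf hg) m),
      RecursiveTower.IsSingularPoint
          (RecursiveTower.curveStruct (RecursiveTower.P1Struct k)
            (RecursiveTower.separatedEmb (RecursiveTower.P1Struct k) f g hf hg) m) P ↔
        ∃ i j : Fin (m + 1), i < j ∧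
          RecursiveTower.IsRamifiedAt f
            (RecursiveTower.coord (RecursiveTower.P1Struct k)
              (RecursiveTower.separatedEmb (RecursiveTower.P1Struct k) f g hf hg) i P) ∧
          RecursiveTower.IsRamifiedAt g
            (RecursiveTower.coord (RecursiveTower.P1Struct k)
              (RecursiveTower.separatedEmb (RecursiveTower.P1Struct k) f g hf hg) j P)) := by
  refine ⟨fun X s _ _ _ Γ ι _ _ _ _ _ _ _ m P => ?_, fun f g hf hg hf' hg' m P => ?_⟩
  · exact RecursiveTower.isSingularPoint_iff_of_isFinite s ι m P
  · exact RecursiveTower.isSingularPoint_iff_of_separated _ f g hf hg hf' hg' m P
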